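/- Let $R$ be a finite commutative local ring with maximal ideal $\mathfrak m$, and let $\xi$ be an $R$-valued random variable such that * $\xi$ is not concentrated on a translate $a+I$ of a proper ideal $I\subsetneq R$, and * $\xi$ is not concentrated on a translate $a+cS$ ($a\in R$, $c\in R^{*}$) of a unit multiple of a proper subring $S\subsetneq R$. For $n\ge 0$ and $u\in\mathbb Z$ with $n+u\ge 0$, let $\mathcal M_{n,n+u}$ be a random $n\times(n+u)$ matrix over $R$ with independent entries, each distributed like $\xi$, except that the entries at an arbitrary (possibly empty) deterministic set of positions are instead uniformly distributed on $R$. Let $\mathbf v_1$ be a random vector in $R^n$ with independent entries distributed like $\xi$, and $\mathbf v_0$ a uniformly distributed vector in $R^n$. For a submodule $B\subseteq R^n$ and a random vector $\mathbf v$ let $\mathbf v+B$ denote the sum of $\mathbf v$ and an independent uniformly distributed element of $B$ (so $\mathbf v_0+B$ is again uniform on $R^n$). Let $d_{TV}$ be the total variation distance, and consider the estimate $$\sum_{M}\mathbb P(\mathcal M_{n,n+u}=M)\; d_{TV}\big(\mathbf v_1+\operatorname{im}(M),\ \mathbf v_0+\operatorname{im}(M)\big)\ \le\ C\,\theta^{n}.\qquad(*)$$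 (Qualitative form.) There is $\theta\in(0,1)$, depending only on $R$ and the distribution of $\xi$, such that for every $u\in\mathbb Z$ there is a constant $C$ for which $(*)$ holds for all $n\ge 0$ with $n+u\ge 0$ and all choices of the set of uniform positions. (Quantitative form.) Let $\|\xi \bmod \mathfrak m\|_2$ and $\|\xi\bmod\mathfrak m\|_\infty$ be the $\ell^2$ and $\ell^\infty$ norms of the probability mass function of the image of $\xi$ in $R/\mathfrak m$. If $$\max\Big(\|\xi \bmod \mathfrak m\|_2,\ \|\xi\bmod\mathfrak m\|_\infty,\ \tfrac1{\operatorname{char}(R/\mathfrak m)}\Big)<\theta<1,$$ then $(*)$ holds for all $n\ge 0$ with $n+u\ge 0$ and all choices of the set of uniform positions, with a constant $C$ that depends only on $u$, $\theta$, $R$ and the smallest non-zero value of $\mathbb P(\xi=r)$, $r\in R$. -/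

import Mathlib

open MeasureTheory ProbabilityTheory

noncomputable section

namespace ColumnSwap

section Entries

variable {R : Type*} [CommRing R] [MeasurableSpace R]

/-- The law `μ` is concentrated on the set `A`. -/
def ConcentratedOn (μ : Measure R) (A : Set R) : Prop := μ Aᶜ = 0

/-- The law `μ` is not concentrated on a translate `a + I` of a proper ideal, nor on a translate
`a + c S` of a unit multiple of a proper subring. -/
structure Nondegenerate (μ : Measure R) : Prop where
  not_ideal : ∀ (I : Ideal R), I ≠ ⊤ → ∀ a : R,
    ¬ ConcentratedOn μ {x | ∃ y ∈ I, x = a + y}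
  not_subring : ∀ (S : Subring R), S ≠ ⊤ → ∀ (a : R) (c : Rˣ),
    ¬ ConcentratedOn μ {x | ∃ s ∈ S, x = a + c * s}

/-- `α` is the smallest non-zero value of `P(ξ = r)`, `r ∈ R`, where `ξ` has law `μ`. -/
def IsMinAtom (μ : Measure R) (α : ℝ) : Prop :=
  IsLeast {p : ℝ | p ≠ 0 ∧ ∃ r : R, μ.real {r} = p} α

variable [IsLocalRing R]

/-- `P(ξ mod 𝔪 = x)`, where `ξ` has law `μ`. -/
def residueProb (μ : Measure R) (x : IsLocalRing.ResidueField R) : ℝ :=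
  μ.real {r | IsLocalRing.residue R r = x}

/-- The `ℓ²` norm of the distribution of `ξ mod 𝔪`. -/
def residueL2 (μ : Measure R) : ℝ :=
  √(∑ᶠ x : IsLocalRing.ResidueField R, residueProb μ x ^ 2)

/-- The `ℓ^∞` norm of the distribution of `ξ mod 𝔪`. -/
def residueLinf (μ : Measure R) : ℝ :=
  ⨆ x : IsLocalRing.ResidueField R, residueProb μ x

/-- `max (‖ξ mod 𝔪‖₂, ‖ξ mod 𝔪‖_∞, 1 / char (R / 𝔪))`. -/
def rate (μ : Measure R) : ℝ :=
  max (residueL2 μ) (max (residueLinf μ) (1 / (ringChar (IsLocalRing.ResidueField R) : ℝ)))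

end Entries

/-- Total variation distance between two probability measures on a finite set. -/
def tvDist {X : Type*} [Fintype X] [MeasurableSpace X] (μ ν : Measure X) : ℝ :=
  (1 / 2) * ∑ x, |μ.real {x} - ν.real {x}|

variable {R : Type*} [CommRing R] [MeasurableSpace R] {n k : ℕ}

/-- The law of `v + B`: the sum of a random vector `v` with law `ν` and an independent uniformly
distributed element of the submodule `B`. -/
def addUniform (ν : Measure (Fin n → R)) (B : Submodule R (Fin n → R)) : Measure (Fin n → R) :=
  ν ∗ uniformOn (B : Set (Fin n → R))

/-- The law of a random vector in `R ^ n` with independent entries of law `μ`. -/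
def iidVector (μ : Measure R) (n : ℕ) : Measure (Fin n → R) :=
  Measure.pi fun _ => μ

/-- The law of a uniformly distributed element of `R ^ n`. -/
def uniformVector (R : Type*) [MeasurableSpace R] (n : ℕ) : Measure (Fin n → R) :=
  uniformOn Set.univ

/-- The image (column span) of a matrix. -/
def im (M : Matrix (Fin n) (Fin k) R) : Submodule R (Fin n → R) :=
  LinearMap.range M.mulVecLin

/-- The random matrix `𝓜` has independent entries; those at the positions in `S` are uniformly
distributed in `R`, all the others have law `μ`. For `S = ∅` this is an i.i.d. matrix. -/
structure IsRandomMatrix (μ : Measure R) (S : Finset (Fin n × Fin k))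
    {Ω : Type*} [MeasurableSpace Ω] (P : Measure Ω)
    (𝓜 : Ω → Matrix (Fin n) (Fin k) R) : Prop where
  indep : iIndepFun (fun (p : Fin n × Fin k) (ω : Ω) => 𝓜 ω p.1 p.2) P
  law : ∀ p : Fin n × Fin k,
    HasLaw (fun ω => 𝓜 ω p.1 p.2) (if p ∈ S then uniformOn Set.univ else μ) P

/-- `∑_M P(𝓜 = M) d_TV(v₁ + im M, v₀ + im M)`, where `v₁` has independent entries of law `μ` and
`v₀` is uniformly distributed. -/
def swapDist [Fintype R] (μ : Measure R) {Ω : Type*} [MeasurableSpace Ω] (P : Measure Ω)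
    (𝓜 : Ω → Matrix (Fin n) (Fin k) R) : ℝ :=
  ∑ M : Matrix (Fin n) (Fin k) R, P.real {ω | 𝓜 ω = M} *
    tvDist (addUniform (iidVector μ n) (im M)) (addUniform (uniformVector R n) (im M))

end ColumnSwap

end

open ColumnSwap

/-! Write a character of `R ^ n` as φ = (φ_1, …, φ_n). By Cauchy–Schwarz and Parseval the total
variation distance is at most the square root of Σ |E φ(v₁)|², taken over the nontrivial φ that are
trivial on im M (`sum_abs_smearedMass_sub_le`). So the question is how likely the random columns are
to be killed by a given φ.

Each φ has a robust subgroup H (`exists_robust_subgroup`): all but a small fraction of the φ_i are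
trivial on H, while every s ∉ H is detected by a positive fraction of them. The probability that φ
kills a random column c is the average over r ∈ R of ∏ E φ_i(c_i r). That product is exponentially
small unless r (x - y) ∈ H for all atoms x, y of ξ, so only the subgroup L of such r matters, and
the probability is essentially |L| / |R| times the probability of being trivial on L. As some x - y
is a unit, |L| ≤ |H|. Nondegeneracy for subrings improves this to |L| ≤ |H| / p, p the residue
characteristic, unless H is an ideal and L = H (`Spreads.ideal_or_card_le`). If H is an ideal but
some φ_i is nontrivial on it, conditioning on the other entries of c gains a factor ρ, a bound for
the mass of a residue class (`colProb_le_of_outlier`).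

This leaves two kinds of φ ≠ 1. For bad φ the columns are killed with probability about (ρ |H| /
|R|)^k, against about (|R| / |H|)^n such φ: a union bound gives nearly ρ^n, and the gap ρ < θ
absorbs the losses. For good φ, H is a proper ideal on which all φ_i are trivial. There the column
probability gains nothing, but Parseval over the characters trivial on H gives Σ |E φ(v₁)|² ≤ ((|R|
/ |H|) ‖ξ mod 𝔪‖₂²)^n, and the square root supplies θ^n. -/

noncomputable section

namespace ColumnSwap

open scoped Classical

/-! ### Orthogonality for characters trivial on a subgroup -/

section Characters

variable {G : Type*} [AddCommGroup G] [Fintype G]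

/-- The characters of `G` that are trivial on the subgroup `H`. -/
def annih (H : AddSubgroup G) : Finset (AddChar G ℂ) :=
  Finset.univ.filter fun χ => ∀ h ∈ H, χ h = 1

lemma mem_annih {H : AddSubgroup G} {χ : AddChar G ℂ} : χ ∈ annih H ↔ ∀ h ∈ H, χ h = 1 := by
  simp [annih]

lemma sum_subgroup_apply (H : AddSubgroup G) (χ : AddChar G ℂ) :
    ∑ h : H, χ h = if χ ∈ annih H then (Nat.card H : ℂ) else 0 := by
  have h := AddChar.sum_eq_ite (χ.compAddMonoidHom H.subtype)
  have e : χ.compAddMonoidHom H.subtype = 0 ↔ χ ∈ annih H := by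
    rw [mem_annih]
    constructor
    · intro h x hx
      simpa using DFunLike.congr_fun h (⟨x, hx⟩ : H)
    · intro h
      ext x
      simpa using h x x.2
  simp only [e] at h
  simpa [Nat.card_eq_fintype_card] using h

lemma sum_annih_apply (H : AddSubgroup G) (s : G) :
    (Nat.card H : ℂ) * ∑ χ ∈ annih H, χ s = if s ∈ H then (Fintype.card G : ℂ) else 0 := by
  have h1 : (Nat.card H : ℂ) * ∑ χ ∈ annih H, χ s = ∑ χ : AddChar G ℂ, ∑ h : H, χ (h + s) := by
    rw [annih, Finset.sum_filter, Finset.mul_sum]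
    refine Finset.sum_congr rfl fun χ _ => ?_
    simp only [AddChar.map_add_eq_mul, ← Finset.sum_mul, sum_subgroup_apply, mem_annih]
    split_ifs <;> simp
  rw [h1, Finset.sum_comm]
  simp only [AddChar.sum_apply_eq_ite]
  split_ifs with hs
  · rw [Finset.sum_eq_single ⟨-s, H.neg_mem hs⟩]
    · simp
    · intro b _ hb
      rw [if_neg]
      intro h
      exact hb (Subtype.ext (eq_neg_of_add_eq_zero_left h))
    · simp
  · refine Finset.sum_eq_zero fun h _ => if_neg fun h0 => hs ?_
    rw [eq_neg_of_add_eq_zero_right h0]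
    exact H.neg_mem h.2

lemma card_mul_card_annih (H : AddSubgroup G) :
    Nat.card H * (annih H).card = Fintype.card G := by
  have h := sum_annih_apply H 0
  simp only [AddChar.map_zero_eq_one, Finset.sum_const, nsmul_eq_mul, mul_one, H.zero_mem,
    if_true] at h
  exact_mod_cast h

lemma one_le_card_annih (H : AddSubgroup G) : (1 : ℝ) ≤ (annih H).card := by
  have h := card_mul_card_annih H
  have hK : 0 < Fintype.card G := Fintype.card_pos
  have : (annih H).card ≠ 0 := by
    intro h0
    rw [h0, mul_zero] at h
    omega
  exact_mod_cast Nat.one_le_iff_ne_zero.2 this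

lemma eq_one_of_mem_annih_top {χ : AddChar G ℂ} (h : χ ∈ annih (⊤ : AddSubgroup G)) : χ = 1 := by
  ext x
  simpa using mem_annih.1 h x trivial

end Characters

/-! ### Robust subgroups of families of characters -/

section Selection

variable {G : Type*} [AddCommGroup G] [Fintype G] {n : ℕ}

/-- The coordinates of `φ` that are not trivial on `H`. -/
def outliers (φ : Fin n → AddChar G ℂ) (H : AddSubgroup G) : Finset (Fin n) :=
  Finset.univ.filter fun i => φ i ∉ annih H

/-- A family of characters admits a subgroup on which almost all of its members are trivial, while
outside of it no element is killed by almost all members. -/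
lemma exists_robust_subgroup (m : ℕ) (φ : Fin n → AddChar G ℂ) :
    ∃ H : AddSubgroup G, m * (outliers φ H).card ≤ n ∧
      ∀ s ∉ H, n ≤ m * Fintype.card G * (Finset.univ.filter fun i => φ i s ≠ 1).card := by
  set K := Fintype.card G
  have hK : 0 < K := Fintype.card_pos
  -- A trade-off: each additional element of `H` pays for `n / (m * K)` more outliers. The summand
  -- `n` is normalised so that `⊥`, which has no outliers, satisfies the inequality with equality.
  let good : Finset (AddSubgroup G) := Finset.univ.filter fun H =>
    m * K * (outliers φ H).card + n ≤ n * Nat.card H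
  have hne : good.Nonempty := by
    refine ⟨⊥, ?_⟩
    have : outliers φ (⊥ : AddSubgroup G) = ∅ := by
      ext i
      simp [outliers, mem_annih]
    simp [good, this]
  obtain ⟨H, hH, hmax⟩ := good.exists_max_image (fun H => Nat.card H) hne
  have hH' : m * K * (outliers φ H).card + n ≤ n * Nat.card H := (Finset.mem_filter.1 hH).2
  have hcard : Nat.card H ≤ K := by
    simpa [K, Nat.card_eq_fintype_card] using Nat.card_le_card_of_injective _ H.subtype_injective
  refine ⟨H, ?_, ?_⟩
  · have h1 : K * (m * (outliers φ H).card) ≤ K * n := by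
      calc K * (m * (outliers φ H).card) = m * K * (outliers φ H).card := by ring
        _ ≤ n * Nat.card H := by omega
        _ ≤ n * K := Nat.mul_le_mul_left _ hcard
        _ = K * n := mul_comm _ _
    exact Nat.le_of_mul_le_mul_left h1 hK
  -- By maximality `H ⊔ ⟨s⟩`, which has at least one more element, violates the inequality. It
  -- therefore has at least `n / (m * K)` new outliers, and each new outlier is nontrivial at `s`.
  · intro s hs
    set H' := H ⊔ AddSubgroup.zmultiples s
    have hlt : Nat.card H < Nat.card H' := by
      have hle : H ≤ H' := le_sup_left
      refine lt_of_le_of_ne (AddSubgroup.card_le_of_le hle) fun h => hs ?_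
      rw [AddSubgroup.eq_of_le_of_card_ge hle h.ge]
      exact (le_sup_right : _ ≤ H') (AddSubgroup.mem_zmultiples s)
    have hng : ¬ (m * K * (outliers φ H').card + n ≤ n * Nat.card H') := by
      intro h
      exact absurd (hmax H' (Finset.mem_filter.2 ⟨Finset.mem_univ _, h⟩)) (by simpa using hlt)
    have hsub : outliers φ H' ⊆ outliers φ H ∪ Finset.univ.filter fun i => φ i s ≠ 1 := by
      intro i hi
      by_contra hcon
      simp only [outliers, Finset.mem_union, Finset.mem_filter, Finset.mem_univ, true_and, not_or,
        not_not] at hcon hi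
      apply hi
      rw [mem_annih]
      intro h hh
      obtain ⟨a, ha, b, hb, rfl⟩ := AddSubgroup.mem_sup.1 hh
      obtain ⟨z, rfl⟩ := AddSubgroup.mem_zmultiples_iff.1 hb
      rw [AddChar.map_add_eq_mul, AddChar.map_zsmul_eq_zpow, mem_annih.1 hcon.1 a ha, hcon.2]
      simp
    have hc := (Finset.card_le_card hsub).trans (Finset.card_union_le _ _)
    have h2 : m * K * (outliers φ H').card ≤ m * K * (outliers φ H).card +
        m * K * (Finset.univ.filter fun i => φ i s ≠ 1).card := by
      rw [← mul_add]; exact Nat.mul_le_mul_left _ hc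
    have h3 : n * Nat.card H + n ≤ n * Nat.card H' := by
      rw [← Nat.mul_succ]; exact Nat.mul_le_mul_left _ hlt
    omega

end Selection

/-! ### Additive subgroups of a finite local ring -/

section LocalRing

variable {R : Type*} [CommRing R] [Fintype R]

variable (R) in
lemma prime_ringChar_residueField [IsLocalRing R] :
    (ringChar (IsLocalRing.ResidueField R)).Prime := by
  have : Finite (IsLocalRing.ResidueField R) :=
    Finite.of_surjective _ IsLocalRing.residue_surjective
  exact CharP.char_is_prime (IsLocalRing.ResidueField R) _

/-- The additive group of `R` is a `p`-group: every other prime is a unit of `R`, so no element has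
that additive order. Hence a nontrivial index is at least `p`. -/
lemma ringChar_mul_card_le [IsLocalRing R] {A B : AddSubgroup R} (h : A < B) :
    ringChar (IsLocalRing.ResidueField R) * Nat.card A ≤ Nat.card B := by
  set p := ringChar (IsLocalRing.ResidueField R) with hp
  have hidx : A.relIndex B ≠ 1 := fun h1 => h.not_ge (AddSubgroup.relIndex_eq_one.1 h1)
  have hmul : Nat.card A * A.relIndex B = Nat.card B := by
    have := AddSubgroup.relIndex_mul_relIndex ⊥ A B bot_le h.le
    simpa using this
  obtain ⟨l, hl, hdvd⟩ := Nat.exists_prime_and_dvd hidx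
  have hlp : l = p := by
    have h1 : l ∣ Nat.card R :=
      (hdvd.trans (Dvd.intro_left _ hmul)).trans B.card_addSubgroup_dvd_card
    have := Fact.mk hl
    obtain ⟨x, hx⟩ := exists_prime_addOrderOf_dvd_card' l h1
    by_contra hne
    have hu : IsUnit ((l : ℕ) : R) := by
      by_contra hnu
      have : IsLocalRing.residue R (l : R) = 0 := by
        rw [IsLocalRing.residue_eq_zero_iff]
        exact (IsLocalRing.mem_maximalIdeal _).2 hnu
      rw [map_natCast, ringChar.spec] at this
      exact hne ((Nat.prime_dvd_prime_iff_eq (prime_ringChar_residueField R) hl).1 this).symm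
    have h0 : (l : R) * x = 0 := by
      rw [← nsmul_eq_mul, ← hx, addOrderOf_nsmul_eq_zero]
    have hx0 : x = 0 := hu.mul_right_eq_zero.1 h0
    rw [hx0, addOrderOf_zero] at hx
    exact hl.one_lt.ne hx
  have hpos : 0 < A.relIndex B := by
    rcases Nat.eq_zero_or_pos (A.relIndex B) with h0 | h0
    · rw [h0, mul_zero] at hmul
      exact absurd hmul.symm Nat.card_pos.ne'
    · exact h0
  rw [← hmul, mul_comm, ← hlp]
  exact Nat.mul_le_mul_left _ (Nat.le_of_dvd hpos hdvd)

/-- The elements `r` with `r (x - y) ∈ H` for all `x, y ∈ S`. -/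
def differenceColon (S : Set R) (H : AddSubgroup R) : AddSubgroup R where
  carrier := {r | ∀ x ∈ S, ∀ y ∈ S, r * (x - y) ∈ H}
  zero_mem' := by simp
  add_mem' := by
    intro a b ha hb x hx y hy
    rw [add_mul]
    exact H.add_mem (ha x hx y hy) (hb x hx y hy)
  neg_mem' := by
    intro a ha x hx y hy
    rw [neg_mul]
    exact H.neg_mem (ha x hx y hy)

/-- The subring of the elements that map `H` to itself. -/
def multiplierRing (H : AddSubgroup R) : Subring R where
  carrier := {t | ∀ h ∈ H, t * h ∈ H}
  mul_mem' := by
    intro a b ha hb h hh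
    rw [mul_assoc]
    exact ha _ (hb _ hh)
  one_mem' := by simp
  add_mem' := by
    intro a b ha hb h hh
    rw [add_mul]
    exact H.add_mem (ha _ hh) (hb _ hh)
  zero_mem' := by simp
  neg_mem' := by
    intro a ha h hh
    rw [neg_mul]
    exact H.neg_mem (ha _ hh)

/-- The set `S` lies in no translate of the maximal ideal, and in no translate of a unit multiple
of a proper subring. -/
structure Spreads [IsLocalRing R] (S : Set R) : Prop where
  exists_unit : ∃ x ∈ S, ∃ y ∈ S, IsUnit (y - x)
  subring_eq_top : ∀ (T : Subring R) (a : R) (c : Rˣ), (∀ x ∈ S, ∃ t ∈ T, x = a + c * t) → T = ⊤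

/-- Multiplication by a unit difference `c = y - x` embeds `L = differenceColon S H` into `H`. If
the image is smaller than `H`, a factor `p` is lost. If it is all of `H`, then `c⁻¹ (z - x)` maps
`H` to itself for every `z ∈ S`, so `S` lies in `x + c T` with `T` the multiplier ring of `H`; hence
`T` is everything and `H` is an ideal. -/
lemma Spreads.ideal_or_card_le [IsLocalRing R] {S : Set R} (hS : Spreads S) (H : AddSubgroup R) :
    ((∀ a, ∀ h ∈ H, a * h ∈ H) ∧ differenceColon S H = H) ∨
      ringChar (IsLocalRing.ResidueField R) * Nat.card (differenceColon S H) ≤ Nat.card H := by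
  obtain ⟨x, hx, y, hy, hu⟩ := hS.exists_unit
  obtain ⟨c, hc⟩ := hu
  set L := differenceColon S H with hL
  let f : R →+ R := AddMonoidHom.mulRight (c : R)
  have hf : Function.Injective f := fun a b hab => c.isUnit.mul_left_injective hab
  have hcard : Nat.card (L.map f) = Nat.card L := AddSubgroup.card_map_of_injective hf
  have hle : L.map f ≤ H := by
    rintro _ ⟨r, hr, rfl⟩
    have := hr y hy x hx
    rwa [← hc] at this
  rcases hle.lt_or_eq with hlt | heq
  · right
    rw [← hcard]
    exact ringChar_mul_card_le hlt
  · left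
    have hT : multiplierRing H = ⊤ := by
      refine hS.subring_eq_top _ x c fun z hz => ⟨(c⁻¹ : Rˣ) * (z - x), ?_, by simp⟩
      intro h hh
      rw [← heq] at hh
      obtain ⟨r, hr, rfl⟩ := hh
      have := hr z hz x hx
      have e : (c⁻¹ : Rˣ) * (z - x) * f r = r * (z - x) := by
        change (c⁻¹ : Rˣ) * (z - x) * (r * c) = _
        calc _ = r * (z - x) * ((c⁻¹ : Rˣ) * (c : R)) := by ring
          _ = _ := by simp
      rwa [e]
    have hI : ∀ a, ∀ h ∈ H, a * h ∈ H := by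
      intro a
      have : a ∈ multiplierRing H := by rw [hT]; trivial
      exact this
    refine ⟨hI, le_antisymm ?_ ?_⟩
    · intro r hr
      have h1 : r * c ∈ H := hle ⟨r, hr, rfl⟩
      have h2 := hI (c⁻¹ : Rˣ) _ h1
      have e : (c⁻¹ : Rˣ) * (r * (c : R)) = r := by
        rw [mul_comm r, Units.inv_mul_cancel_left]
      rwa [e] at h2
    · intro r hr a _ b _
      rw [mul_comm]
      exact hI _ _ hr

end LocalRing

/-! ### Probability that a random column is killed -/

section Column

variable {R : Type*} [CommRing R] {n : ℕ}

/-- The character `r ↦ ∏ i, φ i (c i * r)`. -/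
def colChar (φ : Fin n → AddChar R ℂ) (c : Fin n → R) : AddChar R ℂ :=
  ∏ i, (φ i).mulShift (c i)

lemma colChar_apply (φ : Fin n → AddChar R ℂ) (c : Fin n → R) (r : R) :
    colChar φ c r = ∏ i, φ i (c i * r) := by
  simp [colChar, AddChar.prod_apply]

variable [Fintype R]

lemma norm_expect_char_le_one {e : R → ℝ} (he : ∀ a, 0 ≤ e a) (h1 : ∑ a, e a = 1)
    (χ : AddChar R ℂ) : ‖∑ a, (e a : ℂ) * χ a‖ ≤ 1 := by
  refine (norm_sum_le _ _).trans (le_of_eq ?_)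
  rw [← h1]
  refine Finset.sum_congr rfl fun a _ => ?_
  rw [norm_mul, AddChar.norm_apply, mul_one, Complex.norm_real, Real.norm_of_nonneg (he a)]

variable (R) in
/-- A character that takes different values on two atoms of mass at least `α` has expectation
bounded away from the unit circle. -/
lemma exists_norm_expect_char_le {α : ℝ} (hα : 0 < α) :
    ∃ κ : ℝ, 0 < κ ∧ κ < 1 ∧ ∀ e : R → ℝ, (∀ a, 0 ≤ e a) → ∑ a, e a = 1 →
      ∀ (χ : AddChar R ℂ) (x y : R), α ≤ e x → α ≤ e y → χ (x - y) ≠ 1 →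
        ‖∑ a, (e a : ℂ) * χ a‖ ≤ κ := by
  -- Distinct complex numbers of norm one have a sum of norm less than 2. Only finitely many triples
  -- occur, so a single gap `ε` serves for all.
  have hfin : ∃ ε : ℝ, 0 < ε ∧ ∀ (χ : AddChar R ℂ) (x y : R), χ (x - y) ≠ 1 →
      ‖χ x + χ y‖ ≤ 2 - ε := by
    let T : Finset (AddChar R ℂ × R × R) := Finset.univ.filter fun t => t.1 (t.2.1 - t.2.2) ≠ 1
    have hlt : ∀ t ∈ T, ‖t.1 t.2.1 + t.1 t.2.2‖ < 2 := by
      rintro ⟨χ, x, y⟩ ht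
      have ht : χ (x - y) ≠ 1 := (Finset.mem_filter.1 ht).2
      have hle : ‖χ x + χ y‖ ≤ 2 := by
        refine (norm_add_le _ _).trans (le_of_eq ?_)
        rw [AddChar.norm_apply, AddChar.norm_apply]; norm_num
      refine lt_of_le_of_ne hle fun h => ht ?_
      have : χ x = χ y := by
        refine eq_of_norm_eq_of_norm_add_eq (by simp) ?_
        rw [AddChar.norm_apply, AddChar.norm_apply]
        exact h.trans (by norm_num)
      rw [AddChar.map_sub_eq_div, this, div_self]
      rw [← norm_ne_zero_iff, AddChar.norm_apply]
      exact one_ne_zero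
    rcases T.eq_empty_or_nonempty with hT | hT
    · refine ⟨1, one_pos, fun χ x y h => ?_⟩
      have : (χ, x, y) ∈ T := by simp [T, h]
      simp [hT] at this
    · obtain ⟨t, ht, hmax⟩ := T.exists_max_image (fun t => ‖t.1 t.2.1 + t.1 t.2.2‖) hT
      refine ⟨2 - ‖t.1 t.2.1 + t.1 t.2.2‖, by linarith [hlt t ht], fun χ x y h => ?_⟩
      have := hmax (χ, x, y) (by simp [T, h])
      simp only at this
      linarith
  obtain ⟨ε, hε, hb⟩ := hfin
  -- The `1 / 2` only keeps `κ` positive.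
  refine ⟨max (1 - α * ε) (1 / 2), by positivity, max_lt (by nlinarith [mul_pos hα hε])
    (by norm_num), ?_⟩
  intro e he h1 χ x y hx hy hne
  refine le_trans ?_ (le_max_left _ _)
  have hxy : x ≠ y := by rintro rfl; simp at hne
  -- Mass `α` is split off at both `x` and `y`: the rest contributes at most `1 - 2 * α`, the pair
  -- at most `α * (2 - ε)`.
  let d : R → ℝ := fun a => e a - (if a = x then α else 0) - (if a = y then α else 0)
  have hd : ∀ a, 0 ≤ d a := by
    intro a
    by_cases hax : a = x
    · subst hax; simp [d, hxy, hx]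
    · by_cases hay : a = y
      · subst hay; simp [d, hax, hy]
      · simp [d, hax, hay, he a]
  have hsum : ∑ a, d a = 1 - 2 * α := by
    simp only [d, Finset.sum_sub_distrib, h1, Finset.sum_ite_eq', Finset.mem_univ, if_true]
    ring
  have hdec : ∑ a, (e a : ℂ) * χ a = ∑ a, (d a : ℂ) * χ a + α * (χ x + χ y) := by
    have : ∀ a, (d a : ℂ) * χ a = (e a : ℂ) * χ a - (if a = x then (α : ℂ) * χ x else 0) -
        (if a = y then (α : ℂ) * χ y else 0) := by
      intro a
      by_cases hax : a = x
      · subst hax; simp [d, hxy]; ring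
      · by_cases hay : a = y
        · subst hay; simp [d, hax]; ring
        · simp [d, hax, hay]
    simp only [this, Finset.sum_sub_distrib, Finset.sum_ite_eq', Finset.mem_univ, if_true]
    ring
  rw [hdec]
  calc _ ≤ ‖∑ a, (d a : ℂ) * χ a‖ + ‖(α : ℂ) * (χ x + χ y)‖ := norm_add_le _ _
    _ ≤ (1 - 2 * α) + α * (2 - ε) := by
        refine add_le_add ?_ ?_
        · refine (norm_sum_le _ _).trans (le_of_eq ?_)
          rw [← hsum]
          refine Finset.sum_congr rfl fun a _ => ?_
          rw [norm_mul, AddChar.norm_apply, mul_one, Complex.norm_real, Real.norm_of_nonneg (hd a)]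
        · rw [norm_mul, Complex.norm_real, Real.norm_of_nonneg hα.le]
          exact mul_le_mul_of_nonneg_left (hb χ x y hne) hα.le
    _ = 1 - α * ε := by ring

/-- The probability that `colChar φ c` is trivial on `L` when the entries of `c` are independent
with probability mass functions `e i`. -/
def colProb (e : Fin n → R → ℝ) (φ : Fin n → AddChar R ℂ) (L : AddSubgroup R) : ℝ :=
  ∑ c : Fin n → R, (∏ i, e i (c i)) * if colChar φ c ∈ annih L then 1 else 0

lemma sum_prod_eq_prod_sum {ι κ A : Type*} [Fintype ι] [DecidableEq ι] [Fintype κ]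
    [CommSemiring A]
    (f : ι → κ → A) : ∑ c : ι → κ, ∏ i, f i (c i) = ∏ i, ∑ a, f i a := by
  rw [Finset.prod_univ_sum, Fintype.piFinset_univ]

lemma colProb_nonneg {e : Fin n → R → ℝ} (he : ∀ i a, 0 ≤ e i a) (φ : Fin n → AddChar R ℂ)
    (L : AddSubgroup R) : 0 ≤ colProb e φ L := by
  refine Finset.sum_nonneg fun c _ => mul_nonneg (Finset.prod_nonneg fun i _ => he i _) ?_
  split_ifs <;> norm_num

lemma colProb_le_one {e : Fin n → R → ℝ} (he : ∀ i a, 0 ≤ e i a) (h1 : ∀ i, ∑ a, e i a = 1)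
    (φ : Fin n → AddChar R ℂ) (L : AddSubgroup R) : colProb e φ L ≤ 1 := by
  calc colProb e φ L ≤ ∑ c : Fin n → R, ∏ i, e i (c i) := by
        refine Finset.sum_le_sum fun c _ => ?_
        refine mul_le_of_le_one_right (Finset.prod_nonneg fun i _ => he i _) ?_
        split_ifs <;> norm_num
    _ = 1 := by rw [sum_prod_eq_prod_sum]; simp [h1]

/-- The indicator of being trivial on `L` is the average of the character over `L`; independence of
the entries then factors each expectation. -/
lemma card_mul_colProb (e : Fin n → R → ℝ) (φ : Fin n → AddChar R ℂ) (L : AddSubgroup R) :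
    ((Nat.card L * colProb e φ L : ℝ) : ℂ) =
      ∑ r with r ∈ L, ∏ i, ∑ a, (e i a : ℂ) * (φ i).mulShift r a := by
  have hs : ∀ f : R → ℂ, ∑ r with r ∈ L, f r = ∑ r : L, f r := fun f =>
    Finset.sum_subtype _ (by simp) f
  have h1 : ∀ r : R, ∏ i, ∑ a, (e i a : ℂ) * (φ i).mulShift r a =
      ∑ c : Fin n → R, (∏ i, (e i (c i) : ℂ)) * colChar φ c r := by
    intro r
    rw [← sum_prod_eq_prod_sum]
    refine Finset.sum_congr rfl fun c _ => ?_
    rw [colChar_apply, ← Finset.prod_mul_distrib]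
    refine Finset.prod_congr rfl fun i _ => ?_
    rw [AddChar.mulShift_apply, mul_comm r]
  rw [hs]
  simp only [h1]
  rw [Finset.sum_comm]
  simp only [← Finset.mul_sum, sum_subgroup_apply]
  rw [colProb, Finset.mul_sum]
  push_cast
  refine Finset.sum_congr rfl fun c _ => ?_
  split_ifs <;> push_cast <;> ring

/-- Both probabilities average the same function of `r`, over `R` and over `L`, and the terms
outside `L` are at most `β`. Pulling out `|L| / |R|` enlarges the error by the harmless factor `|L|
≥ 1`. -/
lemma colProb_top_le {e : Fin n → R → ℝ} (he : ∀ i a, 0 ≤ e i a) (φ : Fin n → AddChar R ℂ)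
    (L : AddSubgroup R) {β : ℝ} (hβ0 : 0 ≤ β)
    (hβ : ∀ r ∉ L, ‖∏ i, ∑ a, (e i a : ℂ) * (φ i).mulShift r a‖ ≤ β) :
    colProb e φ ⊤ ≤ Nat.card L / Fintype.card R *
      (colProb e φ L + Fintype.card R * β) := by
  have hK : (0 : ℝ) < Fintype.card R := by exact_mod_cast Fintype.card_pos
  have hL : (1 : ℝ) ≤ Nat.card L := by exact_mod_cast Nat.card_pos (α := L)
  have htop := card_mul_colProb e φ ⊤
  have hLe := card_mul_colProb e φ L
  have h1 : Fintype.card R * colProb e φ ⊤ ≤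
      Nat.card L * colProb e φ L + Fintype.card R * β := by
    have hcard : Nat.card (⊤ : AddSubgroup R) = Fintype.card R := by
      rw [AddSubgroup.card_top, Nat.card_eq_fintype_card]
    rw [hcard] at htop
    have hn := congrArg norm htop
    rw [Complex.norm_real, Real.norm_of_nonneg
      (mul_nonneg hK.le (colProb_nonneg he φ _))] at hn
    rw [hn]
    have hfil : (Finset.univ.filter fun r : R => r ∈ (⊤ : AddSubgroup R)) = Finset.univ := by
      ext; simp
    rw [hfil, ← Finset.sum_filter_add_sum_filter_not Finset.univ (fun r => r ∈ L), ← hLe]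
    refine (norm_add_le _ _).trans (add_le_add ?_ ?_)
    · rw [Complex.norm_real, Real.norm_of_nonneg
        (mul_nonneg (by positivity) (colProb_nonneg he φ _))]
    · refine (norm_sum_le _ _).trans ?_
      calc _ ≤ ∑ r ∈ Finset.univ.filter (fun r : R => r ∉ L), β :=
            Finset.sum_le_sum fun r hr => hβ r (Finset.mem_filter.1 hr).2
        _ ≤ ∑ r : R, β := Finset.sum_le_univ_sum_of_nonneg fun _ => hβ0
        _ = _ := by simp
  rw [div_mul_eq_mul_div, le_div_iff₀ hK, mul_comm]
  refine h1.trans ?_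
  rw [mul_add]
  exact add_le_add le_rfl (le_mul_of_one_le_left (by positivity) hL)

variable [IsLocalRing R]

/-- A probability mass function on `R` with mass at least `α` at the points of `S` and at most `ρ`
on residue classes. -/
structure EntryLaw (S : Set R) (α ρ : ℝ) (e : R → ℝ) : Prop where
  nonneg : ∀ a, 0 ≤ e a
  sum_eq_one : ∑ a, e a = 1
  le_of_mem : ∀ x ∈ S, α ≤ e x
  sum_class_le : ∀ x, ∑ a with IsLocalRing.residue R a = x, e a ≤ ρ

/-- Fix all entries but the `i`-th. If two values `a`, `b` of that entry both succeed and `a - b` is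
a unit, dividing by it inside the ideal `L` shows that `φ i` is trivial on `L`. So all successful
values share one residue class. -/
lemma colProb_le_of_outlier {S : Set R} {α ρ : ℝ} {e : Fin n → R → ℝ}
    (he : ∀ i, EntryLaw S α ρ (e i)) {φ : Fin n → AddChar R ℂ} {L : AddSubgroup R}
    (hL : ∀ a, ∀ h ∈ L, a * h ∈ L) {i : Fin n} (hi : φ i ∉ annih L) :
    colProb e φ L ≤ ρ := by
  have hρ : 0 ≤ ρ := le_trans (Finset.sum_nonneg fun a _ => (he i).nonneg a)
    ((he i).sum_class_le 0)
  have hpi : ∀ f : (Fin n → R) → ℝ, ∑ c, f c =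
      ∑ q : {j // j ≠ i} → R, ∑ a, f ((Equiv.funSplitAt i R).symm (a, q)) := by
    intro f
    rw [← (Equiv.funSplitAt i R).symm.sum_comp, Fintype.sum_prod_type, Finset.sum_comm]
  have hprod : ∀ (f : Fin n → R → ℝ) (a : R) (q : {j // j ≠ i} → R),
      ∏ j, f j ((Equiv.funSplitAt i R).symm (a, q) j) = f i a * ∏ j : {j // j ≠ i}, f j (q j) := by
    intro f a q
    rw [Fintype.prod_eq_mul_prod_subtype_ne _ i]
    congr 1
    · simp
    · refine Finset.prod_congr rfl fun j _ => ?_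
      simp [j.2]
  rw [colProb, hpi]
  have key : ∀ q : {j // j ≠ i} → R,
      ∑ a, (∏ j, e j ((Equiv.funSplitAt i R).symm (a, q) j)) *
        (if colChar φ ((Equiv.funSplitAt i R).symm (a, q)) ∈ annih L then 1 else 0) ≤
      (∏ j : {j // j ≠ i}, e j (q j)) * ρ := by
    intro q
    simp only [hprod]
    have hnn : 0 ≤ ∏ j : {j // j ≠ i}, e j (q j) :=
      Finset.prod_nonneg fun j _ => (he j).nonneg _
    by_cases hex : ∃ b, colChar φ ((Equiv.funSplitAt i R).symm (b, q)) ∈ annih L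
    · obtain ⟨b, hb⟩ := hex
      have hclass : ∀ a, colChar φ ((Equiv.funSplitAt i R).symm (a, q)) ∈ annih L →
          IsLocalRing.residue R a = IsLocalRing.residue R b := by
        intro a ha
        by_contra hne
        have hu : IsUnit (a - b) := by
          by_contra hnu
          apply hne
          rw [← sub_eq_zero, ← map_sub, IsLocalRing.residue_eq_zero_iff]
          exact (IsLocalRing.mem_maximalIdeal _).2 hnu
        obtain ⟨v, hv⟩ := hu
        apply hi
        rw [mem_annih]
        intro h hh
        have hh' := hL (v⁻¹ : Rˣ) h hh
        have h1 := mem_annih.1 ha _ hh'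
        have h2 := mem_annih.1 hb _ hh'
        rw [colChar_apply] at h1 h2
        have hsplit : ∀ d : R, ∏ j, φ j ((Equiv.funSplitAt i R).symm (d, q) j *
            ((v⁻¹ : Rˣ) * h)) = φ i (d * ((v⁻¹ : Rˣ) * h)) *
              ∏ j : {j // j ≠ i}, φ j (q j * ((v⁻¹ : Rˣ) * h)) := by
          intro d
          rw [Fintype.prod_eq_mul_prod_subtype_ne _ i]
          congr 1
          · simp
          · refine Finset.prod_congr rfl fun j _ => ?_
            simp [j.2]
        rw [hsplit] at h1 h2
        have hP : ∏ j : {j // j ≠ i}, φ j (q j * ((v⁻¹ : Rˣ) * h)) ≠ 0 :=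
          right_ne_zero_of_mul (h1.trans_ne one_ne_zero)
        have h3 := mul_right_cancel₀ hP (h1.trans h2.symm)
        have h4 : h = a * ((v⁻¹ : Rˣ) * h) - b * ((v⁻¹ : Rˣ) * h) := by
          rw [← sub_mul, ← hv, Units.mul_inv_cancel_left]
        rw [h4, AddChar.map_sub_eq_div, h3, div_self]
        exact left_ne_zero_of_mul (h2.trans_ne one_ne_zero)
      calc _ ≤ ∑ a, (∏ j : {j // j ≠ i}, e j (q j)) *
            (if IsLocalRing.residue R a = IsLocalRing.residue R b then e i a else 0) := by
            refine Finset.sum_le_sum fun a _ => ?_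
            rw [mul_comm (e i a), mul_assoc]
            refine mul_le_mul_of_nonneg_left ?_ hnn
            by_cases hc : colChar φ ((Equiv.funSplitAt i R).symm (a, q)) ∈ annih L
            · rw [if_pos hc, if_pos (hclass a hc), mul_one]
            · rw [if_neg hc, mul_zero]
              split_ifs
              · exact (he i).nonneg a
              · exact le_rfl
        _ ≤ _ := by
            rw [← Finset.mul_sum, ← Finset.sum_filter]
            exact mul_le_mul_of_nonneg_left ((he i).sum_class_le _) hnn
    · push Not at hex
      simp only [hex, if_false, mul_zero, Finset.sum_const_zero]
      exact mul_nonneg hnn hρ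
  refine (Finset.sum_le_sum fun q _ => key q).trans ?_
  rw [← Finset.sum_mul, sum_prod_eq_prod_sum (fun (j : {j // j ≠ i}) a => e j a)]
  simp [(he _).sum_eq_one]

/-- The bounds for the probability that a random column is killed by a family of characters with
the robust subgroup `H`. -/
lemma colProb_top_le_of_robust {S : Set R} (hS : Spreads S) {α ρ κ r₀ : ℝ} {m : ℕ}
    (hκ : ∀ e : R → ℝ, (∀ a, 0 ≤ e a) → ∑ a, e a = 1 →
      ∀ (χ : AddChar R ℂ) (x y : R), α ≤ e x → α ≤ e y → χ (x - y) ≠ 1 →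
        ‖∑ a, (e a : ℂ) * χ a‖ ≤ κ)
    (hr₀ : 0 ≤ r₀) (hr₁ : r₀ ≤ 1) (hr : r₀ ^ (m * Fintype.card R) = κ)
    (hρ : 1 / (ringChar (IsLocalRing.ResidueField R) : ℝ) ≤ ρ)
    {e : Fin n → R → ℝ} (he : ∀ i, EntryLaw S α ρ (e i)) {φ : Fin n → AddChar R ℂ}
    {H : AddSubgroup R}
    (hH : ∀ s ∉ H, n ≤ m * Fintype.card R * (Finset.univ.filter fun i => φ i s ≠ 1).card) :
    ((∀ a, ∀ h ∈ H, a * h ∈ H) → colProb e φ ⊤ ≤ Nat.card H / Fintype.card R *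
      (1 + Fintype.card R * r₀ ^ n)) ∧
    (¬ ((∀ a, ∀ h ∈ H, a * h ∈ H) ∧ ∀ i, φ i ∈ annih H) → colProb e φ ⊤ ≤
      Nat.card H / Fintype.card R * (ρ + Fintype.card R * r₀ ^ n)) := by
  have hp := prime_ringChar_residueField R
  set p := ringChar (IsLocalRing.ResidueField R)
  have hp0 : (0 : ℝ) < p := by exact_mod_cast hp.pos
  have hK : (0 : ℝ) < Fintype.card R := by exact_mod_cast Fintype.card_pos
  have hnn : ∀ i a, 0 ≤ e i a := fun i => (he i).nonneg
  have hsum : ∀ i, ∑ a, e i a = 1 := fun i => (he i).sum_eq_one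
  set L := differenceColon S H with hLdef
  have hκ0 : 0 ≤ κ := hr ▸ pow_nonneg hr₀ _
  -- For `r ∉ L` some `r * (x - y)` lies outside `H`, so at least `n / (m * |R|)` factors are at
  -- most `κ = r₀ ^ (m * |R|)`.
  have hβ : ∀ r ∉ L, ‖∏ i, ∑ a, (e i a : ℂ) * (φ i).mulShift r a‖ ≤ r₀ ^ n := by
    intro r hrL
    have : ∃ x ∈ S, ∃ y ∈ S, r * (x - y) ∉ H := by
      by_contra hcon
      push Not at hcon
      exact hrL hcon
    obtain ⟨x, hx, y, hy, hxy⟩ := this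
    have hn := hH _ hxy
    set A := Finset.univ.filter fun i => φ i (r * (x - y)) ≠ 1
    calc ‖∏ i, ∑ a, (e i a : ℂ) * (φ i).mulShift r a‖
        = ∏ i, ‖∑ a, (e i a : ℂ) * (φ i).mulShift r a‖ := norm_prod _ _
      _ ≤ ∏ i, if i ∈ A then κ else 1 := by
          refine Finset.prod_le_prod (fun _ _ => norm_nonneg _) fun i _ => ?_
          split_ifs with hi
          · refine hκ (e i) (hnn i) (hsum i) _ x y ((he i).le_of_mem x hx)
              ((he i).le_of_mem y hy) ?_
            rw [AddChar.mulShift_apply]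
            exact (Finset.mem_filter.1 hi).2
          · exact norm_expect_char_le_one (hnn i) (hsum i) _
      _ = r₀ ^ (m * Fintype.card R * A.card) := by
          rw [Finset.prod_ite_mem, Finset.univ_inter, Finset.prod_const, ← hr, ← pow_mul]
      _ ≤ r₀ ^ n := pow_le_pow_of_le_one hr₀ hr₁ hn
  have hmain := colProb_top_le hnn φ L (pow_nonneg hr₀ n) hβ
  have hr₀n : 0 ≤ r₀ ^ n := pow_nonneg hr₀ n
  have hone := colProb_le_one hnn hsum φ L
  rcases hS.ideal_or_card_le H with ⟨hI, hLH⟩ | hcard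
  · rw [← hLdef] at hLH
    rw [hLH] at hmain hone
    refine ⟨fun _ => hmain.trans (by gcongr), fun hout => hmain.trans ?_⟩
    have : ∃ i, φ i ∉ annih H := by
      by_contra hcon
      push Not at hcon
      exact hout ⟨hI, hcon⟩
    obtain ⟨i, hi⟩ := this
    have := colProb_le_of_outlier he hI hi
    gcongr
  · have hcard' : (p : ℝ) * Nat.card L ≤ Nat.card H := by exact_mod_cast hcard
    have hL0 : (0 : ℝ) ≤ Nat.card L := by positivity
    have hp1 : (1 : ℝ) ≤ p := by exact_mod_cast hp.one_le
    have hle : (Nat.card L : ℝ) ≤ Nat.card H * (1 / p) := by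
      rw [mul_one_div, le_div_iff₀ hp0, mul_comm]; exact hcard'
    have hLH : (Nat.card L : ℝ) ≤ Nat.card H :=
      (le_mul_of_one_le_left hL0 hp1).trans hcard'
    have hcol := colProb_nonneg hnn φ L
    refine ⟨fun _ => hmain.trans (by gcongr), fun _ => hmain.trans ?_⟩
    rw [div_mul_eq_mul_div, div_mul_eq_mul_div]
    gcongr ?_ / _
    calc (Nat.card L : ℝ) * (colProb e φ L + Fintype.card R * r₀ ^ n)
        ≤ Nat.card L * (1 + Fintype.card R * r₀ ^ n) := by gcongr
      _ = Nat.card L + Nat.card L * (Fintype.card R * r₀ ^ n) := by ring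
      _ ≤ Nat.card H * ρ + Nat.card H * (Fintype.card R * r₀ ^ n) := by
          gcongr
          exact hle.trans (by gcongr)
      _ = _ := by ring

end Column

/-! ### Fourier analysis on `R ^ n` -/

section Fourier

variable {R : Type*} [CommRing R] {n k : ℕ}

/-- The character `x ↦ ∏ i, φ i (x i)` of `R ^ n`. -/
def vecChar (φ : Fin n → AddChar R ℂ) : AddChar (Fin n → R) ℂ :=
  ∏ i, (φ i).compAddMonoidHom (Pi.evalAddMonoidHom _ i)

lemma vecChar_apply (φ : Fin n → AddChar R ℂ) (x : Fin n → R) :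
    vecChar φ x = ∏ i, φ i (x i) := by
  simp [vecChar, AddChar.prod_apply]

variable [Fintype R]

lemma sum_vecChar_apply (x : Fin n → R) :
    ∑ φ : Fin n → AddChar R ℂ, vecChar φ x =
      if x = 0 then (Fintype.card R : ℂ) ^ n else 0 := by
  simp only [vecChar_apply]
  rw [sum_prod_eq_prod_sum (fun i (χ : AddChar R ℂ) => χ (x i))]
  simp only [AddChar.sum_apply_eq_ite]
  split_ifs with h
  · simp [h]
  · obtain ⟨i, hi⟩ := Function.ne_iff.1 h
    exact Finset.prod_eq_zero (Finset.mem_univ i) (if_neg hi)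

lemma sum_vecChar_eq_zero {φ : Fin n → AddChar R ℂ} (h : φ ≠ 1) :
    ∑ x : Fin n → R, vecChar φ x = 0 := by
  simp only [vecChar_apply]
  rw [sum_prod_eq_prod_sum (fun i (a : R) => φ i a)]
  obtain ⟨i, hi⟩ := Function.ne_iff.1 h
  refine Finset.prod_eq_zero (Finset.mem_univ i) ?_
  rw [AddChar.sum_eq_ite, if_neg]
  rwa [← AddChar.one_eq_zero]

lemma sum_normSq_fourier (h : (Fin n → R) → ℝ) :
    ∑ φ : Fin n → AddChar R ℂ, ‖∑ x, (h x : ℂ) * vecChar φ x‖ ^ 2 =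
      (Fintype.card R : ℝ) ^ n * ∑ x, h x ^ 2 := by
  have hc : ((∑ φ : Fin n → AddChar R ℂ, ‖∑ x, (h x : ℂ) * vecChar φ x‖ ^ 2 : ℝ) : ℂ) =
      (((Fintype.card R : ℝ) ^ n * ∑ x, h x ^ 2 : ℝ) : ℂ) := by
    push_cast
    have h1 : ∀ φ : Fin n → AddChar R ℂ, ((‖∑ x, (h x : ℂ) * vecChar φ x‖ : ℝ) : ℂ) ^ 2 =
        ∑ x, ∑ y, (h x : ℂ) * h y * vecChar φ (x - y) := by
      intro φ
      rw [← Complex.mul_conj', map_sum, Finset.sum_mul_sum]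
      refine Finset.sum_congr rfl fun x _ => Finset.sum_congr rfl fun y _ => ?_
      rw [map_mul, Complex.conj_ofReal, ← AddChar.map_neg_eq_conj, sub_eq_add_neg,
        AddChar.map_add_eq_mul]
      ring
    simp only [h1]
    rw [Finset.sum_comm, Finset.mul_sum]
    refine Finset.sum_congr rfl fun x _ => ?_
    rw [Finset.sum_comm]
    simp only [← Finset.mul_sum, sum_vecChar_apply, sub_eq_zero, mul_ite, mul_zero]
    rw [Finset.sum_ite_eq]
    simp only [Finset.mem_univ, if_true]
    ring
  exact_mod_cast hc

/-- The Fourier transform at `φ` of the law of a vector with independent entries of probability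
mass function `w`. -/
def vecFourier (w : R → ℝ) (φ : Fin n → AddChar R ℂ) : ℂ :=
  ∏ i, ∑ a, (w a : ℂ) * φ i a

/-- The probability mass function of the sum of a vector with independent entries of probability
mass function `w` and a uniform element of `B`. -/
def smearedMass (w : R → ℝ) (B : Submodule R (Fin n → R)) (x : Fin n → R) : ℝ :=
  (Nat.card B : ℝ)⁻¹ * ∑ b : B, ∏ i, w (x i - (b : Fin n → R) i)

lemma smearedMass_nonneg {w : R → ℝ} (hw : ∀ a, 0 ≤ w a) (B : Submodule R (Fin n → R))
    (x : Fin n → R) : 0 ≤ smearedMass w B x :=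
  mul_nonneg (by positivity)
    (Finset.sum_nonneg fun b _ => Finset.prod_nonneg fun i _ => hw _)

lemma fourier_smearedMass (w : R → ℝ) (B : Submodule R (Fin n → R)) (φ : Fin n → AddChar R ℂ) :
    ∑ x, (smearedMass w B x : ℂ) * vecChar φ x =
      vecFourier w φ * if vecChar φ ∈ annih B.toAddSubgroup then 1 else 0 := by
  have hB : (Nat.card B : ℂ) ≠ 0 := by exact_mod_cast (Nat.card_pos (α := B)).ne'
  have h1 : ∀ b : Fin n → R, ∑ x : Fin n → R, (∏ i, (w (x i - b i) : ℂ)) * vecChar φ x =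
      vecFourier w φ * vecChar φ b := by
    intro b
    rw [← Equiv.sum_comp (Equiv.addRight b), vecFourier, ← sum_prod_eq_prod_sum, Finset.sum_mul]
    refine Finset.sum_congr rfl fun x _ => ?_
    simp only [Equiv.coe_addRight, AddChar.map_add_eq_mul, Pi.add_apply, add_sub_cancel_right]
    rw [Finset.prod_mul_distrib, vecChar_apply φ x]
    ring
  have h2 := sum_subgroup_apply B.toAddSubgroup (vecChar φ)
  calc ∑ x, (smearedMass w B x : ℂ) * vecChar φ x
      = (Nat.card B : ℂ)⁻¹ * ∑ b : B, ∑ x : Fin n → R,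
          (∏ i, (w (x i - (b : Fin n → R) i) : ℂ)) * vecChar φ x := by
        rw [Finset.sum_comm, Finset.mul_sum]
        refine Finset.sum_congr rfl fun x _ => ?_
        simp only [smearedMass]
        push_cast
        rw [← Finset.sum_mul]
        ring
    _ = (Nat.card B : ℂ)⁻¹ * (vecFourier w φ * ∑ b : B.toAddSubgroup, vecChar φ b) := by
        simp only [h1]
        rw [← Finset.mul_sum]
        rfl
    _ = _ := by
        rw [h2]
        split_ifs
        · change (Nat.card B : ℂ)⁻¹ * (vecFourier w φ * (Nat.card B : ℂ)) = _
          field_simp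
        · simp

lemma sum_smearedMass {w : R → ℝ} (h1 : ∑ a, w a = 1) (B : Submodule R (Fin n → R)) :
    ∑ x, smearedMass w B x = 1 := by
  have h := fourier_smearedMass w B 1
  have e1 : ∀ x : Fin n → R, vecChar (1 : Fin n → AddChar R ℂ) x = 1 := by
    intro x; simp [vecChar_apply]
  have e2 : vecFourier w (1 : Fin n → AddChar R ℂ) = 1 := by
    simp only [vecFourier, Pi.one_apply, AddChar.one_apply, mul_one]
    rw [← Complex.ofReal_sum, h1]
    simp
  rw [if_pos (mem_annih.2 fun x _ => e1 x), e2, mul_one] at h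
  simp only [e1, mul_one] at h
  exact_mod_cast h

/-- `φ` annihilates the columns of `M`. -/
def Kills (φ : Fin n → AddChar R ℂ) (M : Matrix (Fin n) (Fin k) R) : Prop :=
  ∀ j, colChar φ (fun i => M i j) ∈ annih (⊤ : AddSubgroup R)

lemma kills_of_mem_annih_im {φ : Fin n → AddChar R ℂ} {M : Matrix (Fin n) (Fin k) R}
    (h : vecChar φ ∈ annih (im M).toAddSubgroup) : Kills φ M := by
  intro j
  rw [mem_annih]
  intro r _
  have := mem_annih.1 h (M.mulVec (Pi.single j r)) ⟨Pi.single j r, rfl⟩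
  rw [vecChar_apply] at this
  rw [colChar_apply]
  simpa [Matrix.mulVec_single] using this

/-- Cauchy–Schwarz and Parseval. Subtracting the uniform mass removes exactly the trivial character,
and smearing over `im M` removes every character that is nontrivial there. -/
lemma sum_abs_smearedMass_sub_le {w : R → ℝ} (h1 : ∑ a, w a = 1)
    (M : Matrix (Fin n) (Fin k) R) :
    ∑ x, |smearedMass w (im M) x - ((Fintype.card R : ℝ) ^ n)⁻¹| ≤
      √(∑ φ : Fin n → AddChar R ℂ with φ ≠ 1 ∧ Kills φ M, ‖vecFourier w φ‖ ^ 2) := by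
  set K : ℝ := (Fintype.card R : ℝ) with hKdef
  have hK : 0 < K := by rw [hKdef]; exact_mod_cast Fintype.card_pos
  set h : (Fin n → R) → ℝ := fun x => smearedMass w (im M) x - (K ^ n)⁻¹ with hh
  apply Real.le_sqrt_of_sq_le
  have hcs : (∑ x, |h x|) ^ 2 ≤ K ^ n * ∑ x, h x ^ 2 := by
    have := sq_sum_le_card_mul_sum_sq (s := Finset.univ) (f := fun x => |h x|)
    simpa [hKdef] using this
  refine hcs.trans ?_
  rw [hKdef, ← sum_normSq_fourier, Finset.sum_filter]
  refine Finset.sum_le_sum fun φ _ => ?_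
  have hsplit : ∑ x, (h x : ℂ) * vecChar φ x =
      ∑ x, (smearedMass w (im M) x : ℂ) * vecChar φ x - ((K : ℂ) ^ n)⁻¹ * ∑ x, vecChar φ x := by
    rw [Finset.mul_sum, ← Finset.sum_sub_distrib]
    refine Finset.sum_congr rfl fun x _ => ?_
    simp only [hh]
    push_cast
    ring
  by_cases hφ : φ = 1
  · rw [if_neg (by simp [hφ])]
    have e1 : ∀ x : Fin n → R, vecChar φ x = 1 := by
      intro x; simp [vecChar_apply, hφ]
    have : ∑ x, (h x : ℂ) * vecChar φ x = 0 := by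
      simp only [e1, mul_one]
      rw [← Complex.ofReal_sum]
      simp only [hh, Finset.sum_sub_distrib, sum_smearedMass h1]
      rw [Finset.sum_const, Finset.card_univ]
      simp only [Fintype.card_pi, Finset.prod_const, Finset.card_univ, Fintype.card_fin,
        nsmul_eq_mul]
      push_cast
      rw [hKdef, Complex.ofReal_natCast, mul_inv_cancel₀, sub_self]
      exact pow_ne_zero _ (by exact_mod_cast Fintype.card_ne_zero)
    rw [this]; simp
  · rw [hsplit, sum_vecChar_eq_zero hφ, mul_zero, sub_zero, fourier_smearedMass]
    by_cases ha : vecChar φ ∈ annih (im M).toAddSubgroup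
    · rw [if_pos ha, if_pos ⟨hφ, kills_of_mem_annih_im ha⟩, mul_one]
    · rw [if_neg ha]
      rw [mul_zero, norm_zero, zero_pow two_ne_zero]
      split_ifs <;> positivity

/-- The collision probability of the residue classes of two independent elements of probability
mass function `w`. -/
def residueCollision [IsLocalRing R] (w : R → ℝ) : ℝ :=
  ∑ x, ∑ y, if IsLocalRing.residue R x = IsLocalRing.residue R y then w x * w y else 0

/-- By orthogonality the left side is `|annih H|` times the probability that two independent samples
differ by an element of `H`. A proper ideal lies in the maximal ideal, so such samples have the same
residue. -/
lemma sum_annih_normSq_le [IsLocalRing R] {w : R → ℝ} (hw : ∀ a, 0 ≤ w a) {H : AddSubgroup R}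
    (hI : ∀ a, ∀ h ∈ H, a * h ∈ H) (hH : H ≠ ⊤) :
    ∑ χ ∈ annih H, ‖∑ a, (w a : ℂ) * χ a‖ ^ 2 ≤ (annih H).card * residueCollision w := by
  have hH0 : (0 : ℝ) < Nat.card H := by exact_mod_cast Nat.card_pos (α := H)
  have hcard : (Nat.card H : ℝ) * (annih H).card = Fintype.card R := by
    exact_mod_cast card_mul_card_annih H
  have heq : (Nat.card H : ℝ) * ∑ χ ∈ annih H, ‖∑ a, (w a : ℂ) * χ a‖ ^ 2 =
      Fintype.card R * ∑ x, ∑ y, if x - y ∈ H then w x * w y else 0 := by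
    have hc : (((Nat.card H : ℝ) * ∑ χ ∈ annih H, ‖∑ a, (w a : ℂ) * χ a‖ ^ 2 : ℝ) : ℂ) =
        ((Fintype.card R * ∑ x, ∑ y, if x - y ∈ H then w x * w y else 0 : ℝ) : ℂ) := by
      push_cast
      have h1 : ∀ χ : AddChar R ℂ, ((‖∑ a, (w a : ℂ) * χ a‖ : ℝ) : ℂ) ^ 2 =
          ∑ x, ∑ y, (w x : ℂ) * w y * χ (x - y) := by
        intro χ
        rw [← Complex.mul_conj', map_sum, Finset.sum_mul_sum]
        refine Finset.sum_congr rfl fun x _ => Finset.sum_congr rfl fun y _ => ?_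
        rw [map_mul, Complex.conj_ofReal, ← AddChar.map_neg_eq_conj, sub_eq_add_neg,
          AddChar.map_add_eq_mul]
        ring
      simp only [h1]
      rw [Finset.sum_comm, Finset.mul_sum, Finset.mul_sum]
      refine Finset.sum_congr rfl fun x _ => ?_
      rw [Finset.sum_comm, Finset.mul_sum, Finset.mul_sum]
      refine Finset.sum_congr rfl fun y _ => ?_
      rw [← Finset.mul_sum, mul_left_comm, sum_annih_apply]
      split_ifs <;> push_cast <;> ring
    exact_mod_cast hc
  have hle : ∑ x, ∑ y, (if x - y ∈ H then w x * w y else 0) ≤ residueCollision w := by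
    refine Finset.sum_le_sum fun x _ => Finset.sum_le_sum fun y _ => ?_
    by_cases hxy : x - y ∈ H
    · rw [if_pos hxy, if_pos]
      rw [← sub_eq_zero, ← map_sub, IsLocalRing.residue_eq_zero_iff, IsLocalRing.mem_maximalIdeal]
      rintro ⟨v, hv⟩
      apply hH
      rw [eq_top_iff]
      intro a _
      have := hI (a * (v⁻¹ : Rˣ)) _ hxy
      rwa [← hv, Units.inv_mul_cancel_right] at this
    · rw [if_neg hxy]
      split_ifs
      · exact mul_nonneg (hw _) (hw _)
      · exact le_rfl
  refine le_of_mul_le_mul_left ?_ hH0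
  rw [heq, ← mul_assoc, hcard]
  gcongr

lemma sum_normSq_vecFourier_le [IsLocalRing R] {w : R → ℝ} (hw : ∀ a, 0 ≤ w a)
    {H : AddSubgroup R} (hI : ∀ a, ∀ h ∈ H, a * h ∈ H) (hH : H ≠ ⊤) :
    ∑ φ : Fin n → AddChar R ℂ with ∀ i, φ i ∈ annih H, ‖vecFourier w φ‖ ^ 2 ≤
      ((annih H).card * residueCollision w) ^ n := by
  have hset : (Finset.univ.filter fun φ : Fin n → AddChar R ℂ => ∀ i, φ i ∈ annih H) =
      Fintype.piFinset fun _ => annih H := by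
    ext φ; simp
  rw [hset]
  simp only [vecFourier, norm_prod, ← Finset.prod_pow]
  rw [← Finset.prod_univ_sum (fun _ : Fin n => annih H)
    (fun _ χ => ‖∑ a, (w a : ℂ) * χ a‖ ^ 2), Finset.prod_const, Finset.card_univ,
    Fintype.card_fin]
  exact pow_le_pow_left₀ (Finset.sum_nonneg fun _ _ => by positivity)
    (sum_annih_normSq_le hw hI hH) n

end Fourier

/-! ### Counting families with few outliers -/

section Counting

variable {R : Type*} [CommRing R] [Fintype R] {n k : ℕ}

/-- An exponential Markov bound: with weight `τ⁻¹ ^ m` per outlier, a family with at most `n / m`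
outliers has weight at least `τ⁻¹ ^ n`, and the total weight factors over the coordinates. -/
lemma card_few_outliers_le {τ : ℝ} (hτ : 1 ≤ τ) (m : ℕ) (H : AddSubgroup R) :
    ((Finset.univ.filter fun φ : Fin n → AddChar R ℂ => m * (outliers φ H).card ≤ n).card : ℝ) ≤
      (τ * ((annih H).card * (1 + Fintype.card R * (τ⁻¹) ^ m))) ^ n := by
  have hτ0 : 0 < τ := by linarith
  set t := (τ⁻¹) ^ m with ht
  have ht0 : 0 < t := by positivity
  have ha := one_le_card_annih H
  calc ((Finset.univ.filter fun φ : Fin n → AddChar R ℂ => m * (outliers φ H).card ≤ n).card : ℝ)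
      = ∑ φ : Fin n → AddChar R ℂ with m * (outliers φ H).card ≤ n, (1 : ℝ) := by simp
    _ ≤ ∑ φ : Fin n → AddChar R ℂ with m * (outliers φ H).card ≤ n,
          τ ^ n * ∏ i, (if φ i ∈ annih H then 1 else t) := by
        refine Finset.sum_le_sum fun φ hφ => ?_
        have hφ := (Finset.mem_filter.1 hφ).2
        have hprod : ∏ i, (if φ i ∈ annih H then 1 else t) = t ^ (outliers φ H).card := by
          rw [Finset.prod_ite]
          simp [outliers]
        rw [hprod, ht, ← pow_mul, inv_pow, ← div_eq_mul_inv, one_le_div (by positivity)]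
        exact pow_le_pow_right₀ hτ hφ
    _ ≤ ∑ φ : Fin n → AddChar R ℂ, τ ^ n * ∏ i, (if φ i ∈ annih H then 1 else t) := by
        refine Finset.sum_le_univ_sum_of_nonneg fun φ => mul_nonneg (by positivity) ?_
        exact Finset.prod_nonneg fun i _ => by split_ifs <;> positivity
    _ = τ ^ n * (∑ χ : AddChar R ℂ, if χ ∈ annih H then 1 else t) ^ n := by
        rw [← Finset.mul_sum,
          sum_prod_eq_prod_sum (fun (_ : Fin n) χ => if χ ∈ annih H then (1 : ℝ) else t)]
        simp
    _ ≤ τ ^ n * ((annih H).card * (1 + Fintype.card R * t)) ^ n := by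
        refine mul_le_mul_of_nonneg_left (pow_le_pow_left₀
          (Finset.sum_nonneg fun χ _ => by split_ifs <;> positivity) ?_ n) (by positivity)
        calc (∑ χ : AddChar R ℂ, if χ ∈ annih H then 1 else t)
            ≤ ∑ χ : AddChar R ℂ, ((if χ ∈ annih H then 1 else 0) + t) := by
              refine Finset.sum_le_sum fun χ _ => ?_
              split_ifs <;> linarith
          _ = (annih H).card + Fintype.card R * t := by
              rw [Finset.sum_add_distrib]
              simp
          _ ≤ (annih H).card * (1 + Fintype.card R * t) := by
              have : 0 ≤ Fintype.card R * t := by positivity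
              nlinarith
    _ = _ := (mul_pow _ _ _).symm

/-- Since `n * r ^ n` is bounded, the exponentially small error made in each of the `k` columns
costs only a constant overall. -/
lemma exists_one_add_geom_pow_le {c r : ℝ} (hc : 0 ≤ c) (hr0 : 0 ≤ r) (hr1 : r < 1) (A : ℕ) :
    ∃ C : ℝ, 0 ≤ C ∧ ∀ n k : ℕ, k ≤ n + A → (1 + c * r ^ n) ^ k ≤ C := by
  obtain ⟨D, hD⟩ := (tendsto_self_mul_const_pow_of_lt_one hr0 hr1).bddAbove_range
  refine ⟨Real.exp (c * (D + A)), (Real.exp_pos _).le, fun n k hk => ?_⟩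
  have hn : (n : ℝ) * r ^ n ≤ D := hD ⟨n, rfl⟩
  have hrn : r ^ n ≤ 1 := pow_le_one₀ hr0 hr1.le
  have hrn0 : 0 ≤ r ^ n := pow_nonneg hr0 n
  have hk' : (k : ℝ) ≤ n + A := by exact_mod_cast hk
  calc (1 + c * r ^ n) ^ k ≤ Real.exp (c * r ^ n) ^ k := by
        gcongr
        rw [add_comm]
        exact Real.add_one_le_exp _
    _ = Real.exp (k * (c * r ^ n)) := by rw [← Real.exp_nat_mul]
    _ ≤ Real.exp (c * (D + A)) := by
        apply Real.exp_le_exp.2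
        calc (k : ℝ) * (c * r ^ n) ≤ (n + A) * (c * r ^ n) := by gcongr
          _ = c * (n * r ^ n + A * r ^ n) := by ring
          _ ≤ c * (D + A) := by
              gcongr
              exact mul_le_of_le_one_right (by positivity) hrn

end Counting

/-! ### Matrices with independent entries -/

section MatrixLaw

variable {R : Type*} {n k : ℕ}

/-- The probability of `M` for a random matrix with independent entries of probability mass
functions `e i j`. -/
def matProb (e : Fin n → Fin k → R → ℝ) (M : Matrix (Fin n) (Fin k) R) : ℝ :=
  ∏ j, ∏ i, e i j (M i j)

lemma matProb_nonneg {e : Fin n → Fin k → R → ℝ} (he : ∀ i j a, 0 ≤ e i j a)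
    (M : Matrix (Fin n) (Fin k) R) : 0 ≤ matProb e M :=
  Finset.prod_nonneg fun j _ => Finset.prod_nonneg fun i _ => he i j _

variable [Fintype R]

lemma sum_matProb_mul_prod (e : Fin n → Fin k → R → ℝ) (F : Fin k → (Fin n → R) → ℝ) :
    ∑ M : Matrix (Fin n) (Fin k) R, matProb e M * ∏ j, F j (fun i => M i j) =
      ∏ j, ∑ c : Fin n → R, (∏ i, e i j (c i)) * F j c := by
  rw [← sum_prod_eq_prod_sum]
  refine Fintype.sum_equiv (Equiv.piComm fun _ _ => R) _ _ fun M => ?_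
  exact Finset.prod_mul_distrib.symm

lemma sum_matProb {e : Fin n → Fin k → R → ℝ} (h1 : ∀ i j, ∑ a, e i j a = 1) :
    ∑ M : Matrix (Fin n) (Fin k) R, matProb e M = 1 := by
  have h := sum_matProb_mul_prod e (fun _ _ => 1)
  simp only [Finset.prod_const_one, mul_one] at h
  rw [h]
  refine Finset.prod_eq_one fun j _ => ?_
  rw [sum_prod_eq_prod_sum (fun i a => e i j a)]
  simp [h1]

lemma sum_matProb_kills [CommRing R] (e : Fin n → Fin k → R → ℝ) (φ : Fin n → AddChar R ℂ) :
    ∑ M : Matrix (Fin n) (Fin k) R, matProb e M * (if Kills φ M then 1 else 0) =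
      ∏ j, colProb (fun i => e i j) φ ⊤ := by
  simp only [colProb]
  rw [← sum_matProb_mul_prod e
    (fun _ c => if colChar φ c ∈ annih (⊤ : AddSubgroup R) then (1 : ℝ) else 0)]
  refine Finset.sum_congr rfl fun M _ => ?_
  congr 1
  rw [Finset.prod_ite_zero]
  simp only [Finset.prod_const_one]
  exact if_congr (by simp [Kills]) rfl rfl

end MatrixLaw

/-! ### The estimate for probability mass functions -/

section Estimate

variable {R : Type*} [CommRing R] [Fintype R] {n k : ℕ}

lemma card_div_card_eq (H : AddSubgroup R) :
    (Nat.card H : ℝ) / Fintype.card R = ((annih H).card : ℝ)⁻¹ := by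
  have h : (Nat.card H : ℝ) * (annih H).card = Fintype.card R := by
    exact_mod_cast card_mul_card_annih H
  have hH : (0 : ℝ) < Nat.card H := by exact_mod_cast Nat.card_pos (α := H)
  rw [← h, div_mul_cancel_left₀ hH.ne']

/-- The density of `H` is the inverse of `|annih H|`, so everything cancels except `|annih H| ^ (n -
k)`. -/
lemma card_div_card_pow_mul_le (H : AddSubgroup R) {A : ℕ} (hnk : n ≤ k + A) :
    ((Nat.card H : ℝ) / Fintype.card R) ^ k * ((annih H).card : ℝ) ^ n ≤
      (Fintype.card R : ℝ) ^ A := by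
  have h1 := one_le_card_annih H
  have ha : ((annih H).card : ℝ) ≤ Fintype.card R := by
    exact_mod_cast (Finset.card_le_univ (annih H)).trans AddChar.card_eq.le
  rw [card_div_card_eq, inv_pow, inv_mul_le_iff₀ (by positivity)]
  calc ((annih H).card : ℝ) ^ n ≤ ((annih H).card : ℝ) ^ (k + A) := pow_le_pow_right₀ h1 hnk
    _ = ((annih H).card : ℝ) ^ k * ((annih H).card : ℝ) ^ A := pow_add _ _ _
    _ ≤ _ := by gcongr

lemma sum_mul_sqrt_le {ι : Type*} [Fintype ι] {P g : ι → ℝ} (hP : ∀ i, 0 ≤ P i)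
    (h1 : ∑ i, P i = 1) (hg : ∀ i, 0 ≤ g i) : ∑ i, P i * √(g i) ≤ √(∑ i, P i * g i) := by
  apply Real.le_sqrt_of_sq_le
  have := Finset.sum_sq_le_sum_mul_sum_of_sq_le_mul Finset.univ (r := fun i => P i * √(g i))
    (f := P) (g := fun i => P i * g i) (fun i _ => hP i) (fun i _ => mul_nonneg (hP i) (hg i))
    (fun i _ => le_of_eq (by rw [mul_pow, Real.sq_sqrt (hg i)]; ring))
  simpa [h1] using this

/-- Splitting the nontrivial families of characters into the good ones, treated by Fourier analysis,
and the bad ones, treated by a union bound. -/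
lemma sum_matProb_mul_le_add_sqrt {w : R → ℝ} {e : Fin n → Fin k → R → ℝ}
    (he : ∀ i j a, 0 ≤ e i j a) (h1 : ∀ i j, ∑ a, e i j a = 1)
    {T : Matrix (Fin n) (Fin k) R → ℝ} (hT1 : ∀ M, T M ≤ 1)
    (hT : ∀ M, T M ≤
      √(∑ φ : Fin n → AddChar R ℂ with φ ≠ 1 ∧ Kills φ M, ‖vecFourier w φ‖ ^ 2))
    (good : (Fin n → AddChar R ℂ) → Prop) :
    ∑ M, matProb e M * T M ≤
      ∑ φ : Fin n → AddChar R ℂ with φ ≠ 1 ∧ ¬ good φ, ∏ j, colProb (fun i => e i j) φ ⊤ +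
      √(∑ φ : Fin n → AddChar R ℂ with good φ,
        (∏ j, colProb (fun i => e i j) φ ⊤) * ‖vecFourier w φ‖ ^ 2) := by
  let bad : Finset (Fin n → AddChar R ℂ) := Finset.univ.filter fun φ => φ ≠ 1 ∧ ¬ good φ
  let gd : Finset (Fin n → AddChar R ℂ) := Finset.univ.filter fun φ => good φ
  let kl : (Fin n → AddChar R ℂ) → Matrix (Fin n) (Fin k) R → ℝ :=
    fun φ M => if Kills φ M then 1 else 0
  have hkl : ∀ φ M, 0 ≤ kl φ M := fun φ M => by
    simp only [kl]; split_ifs <;> norm_num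
  have hpt : ∀ M, T M ≤ ∑ φ ∈ bad, kl φ M + √(∑ φ ∈ gd, kl φ M * ‖vecFourier w φ‖ ^ 2) := by
    intro M
    by_cases hex : ∃ φ ∈ bad, Kills φ M
    · obtain ⟨φ, hφ, hk⟩ := hex
      have h2 : kl φ M ≤ ∑ φ ∈ bad, kl φ M :=
        Finset.single_le_sum (f := fun φ => kl φ M) (fun φ _ => hkl φ M) hφ
      have h3 : kl φ M = 1 := if_pos hk
      have h4 := Real.sqrt_nonneg (∑ φ ∈ gd, kl φ M * ‖vecFourier w φ‖ ^ 2)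
      linarith [hT1 M]
    · push Not at hex
      have h2 : 0 ≤ ∑ φ ∈ bad, kl φ M := Finset.sum_nonneg fun φ _ => hkl φ M
      refine (hT M).trans (le_add_of_nonneg_of_le h2 (Real.sqrt_le_sqrt ?_))
      have hsub : (Finset.univ.filter fun φ : Fin n → AddChar R ℂ => φ ≠ 1 ∧ Kills φ M) ⊆ gd := by
        intro φ hφ
        have hφ := (Finset.mem_filter.1 hφ).2
        by_contra hng
        have hng' : ¬ good φ := fun h => hng (Finset.mem_filter.2 ⟨Finset.mem_univ _, h⟩)
        exact hex φ (Finset.mem_filter.2 ⟨Finset.mem_univ _, hφ.1, hng'⟩) hφ.2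
      calc ∑ φ : Fin n → AddChar R ℂ with φ ≠ 1 ∧ Kills φ M, ‖vecFourier w φ‖ ^ 2
          = ∑ φ : Fin n → AddChar R ℂ with φ ≠ 1 ∧ Kills φ M,
              kl φ M * ‖vecFourier w φ‖ ^ 2 := by
            refine Finset.sum_congr rfl fun φ hφ => ?_
            have : kl φ M = 1 := if_pos (Finset.mem_filter.1 hφ).2.2
            rw [this, one_mul]
        _ ≤ _ := Finset.sum_le_sum_of_subset_of_nonneg hsub fun φ _ _ =>
            mul_nonneg (hkl φ M) (by positivity)
  have hP := matProb_nonneg he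
  calc ∑ M, matProb e M * T M
      ≤ ∑ M, matProb e M * (∑ φ ∈ bad, kl φ M +
          √(∑ φ ∈ gd, kl φ M * ‖vecFourier w φ‖ ^ 2)) :=
        Finset.sum_le_sum fun M _ => mul_le_mul_of_nonneg_left (hpt M) (hP M)
    _ = ∑ M, matProb e M * ∑ φ ∈ bad, kl φ M +
          ∑ M, matProb e M * √(∑ φ ∈ gd, kl φ M * ‖vecFourier w φ‖ ^ 2) := by
        rw [← Finset.sum_add_distrib]
        exact Finset.sum_congr rfl fun M _ => mul_add _ _ _
    _ ≤ ∑ M, matProb e M * ∑ φ ∈ bad, kl φ M +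
          √(∑ M, matProb e M * ∑ φ ∈ gd, kl φ M * ‖vecFourier w φ‖ ^ 2) := by
        refine add_le_add le_rfl (sum_mul_sqrt_le hP (sum_matProb h1) fun M => ?_)
        exact Finset.sum_nonneg fun φ _ => mul_nonneg (hkl φ M) (by positivity)
    _ = _ := by
        have hb : ∑ M, matProb e M * ∑ φ ∈ bad, kl φ M =
            ∑ φ ∈ bad, ∏ j, colProb (fun i => e i j) φ ⊤ := by
          simp only [Finset.mul_sum]
          rw [Finset.sum_comm]
          exact Finset.sum_congr rfl fun φ _ => sum_matProb_kills e φ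
        have hg : ∑ M, matProb e M * ∑ φ ∈ gd, kl φ M * ‖vecFourier w φ‖ ^ 2 =
            ∑ φ ∈ gd, (∏ j, colProb (fun i => e i j) φ ⊤) * ‖vecFourier w φ‖ ^ 2 := by
          simp only [Finset.mul_sum]
          rw [Finset.sum_comm]
          refine Finset.sum_congr rfl fun φ _ => ?_
          simp only [← mul_assoc]
          rw [← Finset.sum_mul, sum_matProb_kills]
        rw [hb, hg]

lemma sum_filter_le_sum_fiberwise {ι κ : Type*} [Fintype ι] [Fintype κ] (f : ι → ℝ) (g : ι → κ)
    (s : Finset ι) (b : κ → ℝ) (h : ∀ y, ∑ i ∈ s with g i = y, f i ≤ b y) :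
    ∑ i ∈ s, f i ≤ ∑ y, b y := by
  rw [← Finset.sum_fiberwise s g f]
  exact Finset.sum_le_sum fun y _ => h y

lemma exists_one_add_mul_inv_pow_le {τ : ℝ} (hτ : 1 < τ) {c : ℝ} (hc : 0 < c) :
    ∃ m : ℕ, m ≠ 0 ∧ 1 + c * τ⁻¹ ^ m ≤ τ := by
  obtain ⟨m, hm⟩ := exists_pow_lt_of_lt_one (div_pos (sub_pos.2 hτ) hc) (inv_lt_one_of_one_lt₀ hτ)
  refine ⟨m + 1, by omega, ?_⟩
  have h0 : (0 : ℝ) < τ⁻¹ := by positivity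
  have h1 : τ⁻¹ ^ (m + 1) ≤ τ⁻¹ ^ m :=
    pow_le_pow_of_le_one h0.le (inv_lt_one_of_one_lt₀ hτ).le (Nat.le_succ m)
  have h2 := (h1.trans_lt hm).le
  rw [le_div_iff₀ hc] at h2
  linarith

variable (R) in
/-- The column-swapping estimate in terms of probability mass functions. -/
theorem exists_sum_matProb_mul_le [IsLocalRing R] {α ρ θ : ℝ} (hα : 0 < α)
    (hρ : 1 / (ringChar (IsLocalRing.ResidueField R) : ℝ) ≤ ρ) (hρθ : ρ < θ) (hθ : θ < 1)
    (A : ℕ) :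
    ∃ C : ℝ, ∀ (S : Set R), Spreads S → ∀ w : R → ℝ, (∀ a, 0 ≤ w a) →
      residueCollision w ≤ θ ^ 2 → ∀ n k : ℕ, n ≤ k + A → k ≤ n + A →
      ∀ e : Fin n → Fin k → R → ℝ, (∀ i j, EntryLaw S α ρ (e i j)) →
      ∀ T : Matrix (Fin n) (Fin k) R → ℝ, (∀ M, T M ≤ 1) →
      (∀ M, T M ≤
        √(∑ φ : Fin n → AddChar R ℂ with φ ≠ 1 ∧ Kills φ M, ‖vecFourier w φ‖ ^ 2)) →
      ∑ M, matProb e M * T M ≤ C * θ ^ n := by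
  set K : ℝ := (Fintype.card R : ℝ) with hKdef
  have hK : 0 < K := by rw [hKdef]; exact_mod_cast Fintype.card_pos
  have hρ0 : 0 < ρ := lt_of_lt_of_le
    (one_div_pos.2 (by exact_mod_cast (prime_ringChar_residueField R).pos)) hρ
  have hθ0 : 0 < θ := hρ0.trans hρθ
  -- The gap between `ρ` and `θ` is `τ * τ`: one factor is the `τ` of `card_few_outliers_le`, the
  -- other bounds `1 + K * τ⁻¹ ^ m`, by the choice of `m`.
  set τ := √(θ / ρ) with hτdef
  have hτ2 : τ * τ = θ / ρ := Real.mul_self_sqrt (by positivity)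
  have hτ : 1 < τ := by
    rw [hτdef, Real.lt_sqrt zero_le_one, one_pow, one_lt_div hρ0]
    exact hρθ
  obtain ⟨m, hm0, hm⟩ := exists_one_add_mul_inv_pow_le hτ hK
  obtain ⟨κ, hκ0, hκ1, hκ⟩ := exists_norm_expect_char_le R hα
  have hmK : m * Fintype.card R ≠ 0 := mul_ne_zero hm0 Fintype.card_ne_zero
  set r₀ : ℝ := κ ^ (((m * Fintype.card R : ℕ) : ℝ)⁻¹) with hr₀def
  have hr : r₀ ^ (m * Fintype.card R) = κ := Real.rpow_inv_natCast_pow hκ0.le hmK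
  have hr₀ : 0 ≤ r₀ := Real.rpow_nonneg hκ0.le _
  have hr₁ : r₀ < 1 := Real.rpow_lt_one hκ0.le hκ1
    (inv_pos.2 (by exact_mod_cast Nat.pos_of_ne_zero hmK))
  obtain ⟨C₁, hC₁0, hC₁⟩ := exists_one_add_geom_pow_le hK.le hr₀ hr₁ A
  obtain ⟨C₂, hC₂0, hC₂⟩ := exists_one_add_geom_pow_le (div_pos hK hρ0).le hr₀ hr₁ A
  set N : ℝ := (Fintype.card (AddSubgroup R) : ℝ) with hN
  refine ⟨N * (K ^ A * (ρ⁻¹ ^ A * C₂)) + √(N * (K ^ A * C₁)), ?_⟩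
  intro S hS w hw hcol n k hnk hkn e he T hT1 hT
  have hnn : ∀ i j a, 0 ≤ e i j a := fun i j => (he i j).nonneg
  choose Hf hfew hrob using fun φ : Fin n → AddChar R ℂ => exists_robust_subgroup m φ
  -- Demanding `Hf φ ≠ ⊤` costs nothing: a family whose members are all trivial on `⊤` is `1`, which
  -- the union bound omits.
  obtain ⟨good, hgood⟩ : ∃ good : (Fin n → AddChar R ℂ) → Prop, ∀ φ, good φ ↔
      (∀ a, ∀ h ∈ Hf φ, a * h ∈ Hf φ) ∧ Hf φ ≠ ⊤ ∧ ∀ i, φ i ∈ annih (Hf φ) :=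
    ⟨_, fun _ => Iff.rfl⟩
  have hcolb := fun φ j => colProb_top_le_of_robust hS hκ hr₀ hr₁.le hr hρ
    (e := fun i => e i j) (fun i => he i j) (φ := φ) (H := Hf φ) (hrob φ)
  have hcn : ∀ φ j, 0 ≤ colProb (fun i => e i j) φ ⊤ := fun φ j =>
    colProb_nonneg (fun i => hnn i j) φ ⊤
  have hprod : ∀ (φ : Fin n → AddChar R ℂ) (b : ℝ),
      (∀ j, colProb (fun i => e i j) φ ⊤ ≤ b) → ∏ j, colProb (fun i => e i j) φ ⊤ ≤ b ^ k := by
    intro φ b hb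
    refine (Finset.prod_le_prod (fun j _ => hcn φ j) fun j _ => hb j).trans (le_of_eq ?_)
    simp
  refine (sum_matProb_mul_le_add_sqrt hnn (fun i j => (he i j).sum_eq_one) hT1 hT good).trans ?_
  rw [add_mul]
  refine add_le_add ?_ ?_
  · have hsum := sum_filter_le_sum_fiberwise
      (fun φ : Fin n → AddChar R ℂ => ∏ j, colProb (fun i => e i j) φ ⊤) Hf
      (Finset.univ.filter fun φ => φ ≠ 1 ∧ ¬ good φ)
      (fun _ => K ^ A * (ρ⁻¹ ^ A * C₂) * θ ^ n) ?_
    · refine hsum.trans (le_of_eq ?_)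
      rw [Finset.sum_const, Finset.card_univ, nsmul_eq_mul, ← hN]
      ring
    intro H
    set a : ℝ := ((annih H).card : ℝ) with ha
    set q : ℝ := (Nat.card H : ℝ) / K with hq
    have hq0 : 0 ≤ q := by positivity
    have hterm : ∀ φ ∈ (Finset.univ.filter fun φ : Fin n → AddChar R ℂ =>
        φ ≠ 1 ∧ ¬ good φ).filter (fun φ => Hf φ = H),
        ∏ j, colProb (fun i => e i j) φ ⊤ ≤ q ^ k * (ρ ^ k * C₂) := by
      intro φ hφ
      obtain ⟨hφ1, hH⟩ := Finset.mem_filter.1 hφ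
      obtain ⟨hne, hng⟩ := (Finset.mem_filter.1 hφ1).2
      have hbad : ¬ ((∀ a, ∀ h ∈ Hf φ, a * h ∈ Hf φ) ∧ ∀ i, φ i ∈ annih (Hf φ)) := by
        rintro ⟨hI, hin⟩
        refine hng ((hgood φ).2 ⟨hI, fun htop => hne ?_, hin⟩)
        funext i
        have := hin i
        rw [htop] at this
        exact eq_one_of_mem_annih_top this
      refine (hprod φ (q * (ρ + K * r₀ ^ n)) fun j => ?_).trans ?_
      · have := (hcolb φ j).2 hbad
        rwa [hH] at this
      · rw [mul_pow]
        refine mul_le_mul_of_nonneg_left ?_ (pow_nonneg hq0 k)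
        have e1 : ρ + K * r₀ ^ n = ρ * (1 + K / ρ * r₀ ^ n) := by field_simp
        rw [e1, mul_pow]
        exact mul_le_mul_of_nonneg_left (hC₂ n k hkn) (by positivity)
    refine (Finset.sum_le_card_nsmul _ _ _ hterm).trans ?_
    rw [nsmul_eq_mul]
    have hcount : ((((Finset.univ.filter fun φ : Fin n → AddChar R ℂ =>
        φ ≠ 1 ∧ ¬ good φ).filter (fun φ => Hf φ = H)).card : ℕ) : ℝ) ≤
        (τ * (a * (1 + K * τ⁻¹ ^ m))) ^ n := by
      refine le_trans ?_ (card_few_outliers_le hτ.le m H)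
      have : ((Finset.univ.filter fun φ : Fin n → AddChar R ℂ =>
        φ ≠ 1 ∧ ¬ good φ).filter (fun φ => Hf φ = H)) ⊆
        Finset.univ.filter fun φ : Fin n → AddChar R ℂ => m * (outliers φ H).card ≤ n := by
        intro φ hφ
        have hH := (Finset.mem_filter.1 hφ).2
        exact Finset.mem_filter.2 ⟨Finset.mem_univ _, hH ▸ hfew φ⟩
      exact_mod_cast Finset.card_le_card this
    have hqa : q ^ k * a ^ n ≤ K ^ A := card_div_card_pow_mul_le H hnk
    have hρk : ρ ^ k ≤ ρ ^ n * ρ⁻¹ ^ A := by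
      rw [inv_pow, ← div_eq_mul_inv, le_div_iff₀ (by positivity), ← pow_add]
      exact pow_le_pow_of_le_one hρ0.le (hρθ.trans hθ).le hnk
    have hbase : τ * (1 + K * τ⁻¹ ^ m) * ρ ≤ θ := by
      calc τ * (1 + K * τ⁻¹ ^ m) * ρ ≤ τ * τ * ρ := by gcongr
        _ = θ := by rw [hτ2]; field_simp
    have ha0 : 0 ≤ a := by positivity
    have hτ0 : 0 < τ := by linarith
    calc _ ≤ (τ * (a * (1 + K * τ⁻¹ ^ m))) ^ n * (q ^ k * (ρ ^ k * C₂)) := by gcongr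
      _ ≤ (τ * (a * (1 + K * τ⁻¹ ^ m))) ^ n * (q ^ k * ((ρ ^ n * ρ⁻¹ ^ A) * C₂)) := by gcongr
      _ = (q ^ k * a ^ n) * (ρ⁻¹ ^ A * C₂) * (τ * (1 + K * τ⁻¹ ^ m) * ρ) ^ n := by
          simp only [mul_pow]; ring
      _ ≤ K ^ A * (ρ⁻¹ ^ A * C₂) * θ ^ n := by gcongr
  -- Here the column probabilities merely cancel the number of characters. The gain is the collision
  -- bound `θ ^ 2` per coordinate, and the square root turns it into `θ ^ n`.
  · have hgoodsum : ∑ φ : Fin n → AddChar R ℂ with good φ,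
        (∏ j, colProb (fun i => e i j) φ ⊤) * ‖vecFourier w φ‖ ^ 2 ≤
        N * (K ^ A * C₁) * (θ ^ n) ^ 2 := by
      have hsum := sum_filter_le_sum_fiberwise
        (fun φ : Fin n → AddChar R ℂ =>
          (∏ j, colProb (fun i => e i j) φ ⊤) * ‖vecFourier w φ‖ ^ 2) Hf
        (Finset.univ.filter fun φ => good φ)
        (fun _ => K ^ A * C₁ * (θ ^ n) ^ 2) ?_
      · refine hsum.trans (le_of_eq ?_)
        rw [Finset.sum_const, Finset.card_univ, nsmul_eq_mul, ← hN]
        ring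
      intro H
      by_cases hHI : (∀ a, ∀ h ∈ H, a * h ∈ H) ∧ H ≠ ⊤
      swap
      · rw [Finset.sum_eq_zero]
        · positivity
        · intro φ hφ
          obtain ⟨hφ1, hH⟩ := Finset.mem_filter.1 hφ
          have hg := (hgood φ).1 (Finset.mem_filter.1 hφ1).2
          exact absurd (hH ▸ ⟨hg.1, hg.2.1⟩) hHI
      obtain ⟨hI, hHtop⟩ := hHI
      set a : ℝ := ((annih H).card : ℝ) with ha
      set q : ℝ := (Nat.card H : ℝ) / K with hq
      have hq0 : 0 ≤ q := by positivity
      have ha0 : 0 ≤ a := by positivity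
      have hqa : q ^ k * a ^ n ≤ K ^ A := card_div_card_pow_mul_le H hnk
      have hcol0 : 0 ≤ residueCollision w :=
        Finset.sum_nonneg fun x _ => Finset.sum_nonneg fun y _ => by
          split_ifs
          · exact mul_nonneg (hw _) (hw _)
          · exact le_rfl
      calc _ ≤ ∑ φ ∈ (Finset.univ.filter fun φ : Fin n → AddChar R ℂ => good φ).filter
              (fun φ => Hf φ = H), q ^ k * C₁ * ‖vecFourier w φ‖ ^ 2 := by
            refine Finset.sum_le_sum fun φ hφ => ?_
            obtain ⟨hφ1, hH⟩ := Finset.mem_filter.1 hφ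
            have hg := (hgood φ).1 (Finset.mem_filter.1 hφ1).2
            refine mul_le_mul_of_nonneg_right ?_ (by positivity)
            refine (hprod φ (q * (1 + K * r₀ ^ n)) fun j => ?_).trans ?_
            · have := (hcolb φ j).1 hg.1
              rwa [hH] at this
            · rw [mul_pow]
              exact mul_le_mul_of_nonneg_left (hC₁ n k hkn) (pow_nonneg hq0 k)
        _ ≤ ∑ φ : Fin n → AddChar R ℂ with ∀ i, φ i ∈ annih H,
              q ^ k * C₁ * ‖vecFourier w φ‖ ^ 2 := by
            refine Finset.sum_le_sum_of_subset_of_nonneg ?_ fun φ _ _ => by positivity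
            intro φ hφ
            obtain ⟨hφ1, hH⟩ := Finset.mem_filter.1 hφ
            have hg := (hgood φ).1 (Finset.mem_filter.1 hφ1).2
            exact Finset.mem_filter.2 ⟨Finset.mem_univ _, hH ▸ hg.2.2⟩
        _ ≤ q ^ k * C₁ * (a * θ ^ 2) ^ n := by
            rw [← Finset.mul_sum]
            refine mul_le_mul_of_nonneg_left ?_ (by positivity)
            refine (sum_normSq_vecFourier_le hw hI hHtop).trans ?_
            gcongr
        _ = (q ^ k * a ^ n) * C₁ * (θ ^ n) ^ 2 := by rw [mul_pow, ← pow_mul, ← pow_mul]; ring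
        _ ≤ K ^ A * C₁ * (θ ^ n) ^ 2 := by gcongr
    calc _ ≤ √(N * (K ^ A * C₁) * (θ ^ n) ^ 2) := Real.sqrt_le_sqrt hgoodsum
      _ = _ := by
        rw [Real.sqrt_mul (by positivity), Real.sqrt_sq (by positivity)]

end Estimate

/-! ### Residue classes under the uniform law -/

section ResidueClasses

variable (R : Type*) [CommRing R] [IsLocalRing R] [Fintype R]

lemma uniform_sum_class_le (x : IsLocalRing.ResidueField R) :
    ∑ a : R with IsLocalRing.residue R a = x, (Fintype.card R : ℝ)⁻¹ ≤
      1 / (ringChar (IsLocalRing.ResidueField R) : ℝ) := by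
  set m := (IsLocalRing.maximalIdeal R).toAddSubgroup with hm
  have hlt : m < ⊤ := by
    rw [lt_top_iff_ne_top]
    intro htop
    have : (1 : R) ∈ m := by rw [htop]; trivial
    exact (Ideal.ne_top_iff_one _).1 (Ideal.IsPrime.ne_top' (I := IsLocalRing.maximalIdeal R)) this
  have hcard := ringChar_mul_card_le hlt
  rw [AddSubgroup.card_top, Nat.card_eq_fintype_card (α := R)] at hcard
  obtain ⟨b, rfl⟩ := IsLocalRing.residue_surjective x
  have hle : (Finset.univ.filter fun a : R =>
      IsLocalRing.residue R a = IsLocalRing.residue R b).card ≤ Nat.card m := by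
    rw [Nat.card_eq_fintype_card, ← Finset.card_univ]
    refine Finset.card_le_card_of_surjOn (fun y : m => (y : R) + b) ?_
    intro a ha
    have ha : IsLocalRing.residue R a = IsLocalRing.residue R b := by simpa using ha
    refine ⟨⟨a - b, ?_⟩, by simp, by simp⟩
    change a - b ∈ IsLocalRing.maximalIdeal R
    rw [← IsLocalRing.residue_eq_zero_iff, map_sub, ha, sub_self]
  have hp := prime_ringChar_residueField R
  have hK : (0 : ℝ) < Fintype.card R := by exact_mod_cast Fintype.card_pos
  rw [Finset.sum_const, nsmul_eq_mul, ← div_eq_mul_inv, div_le_div_iff₀ hK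
    (by exact_mod_cast hp.pos), one_mul, mul_comm]
  exact_mod_cast (Nat.mul_le_mul_left _ hle).trans hcard

end ResidueClasses

/-! ### From measures to mass functions -/

section Laws

variable {R : Type*} [MeasurableSpace R] [Fintype R] [DiscreteMeasurableSpace R]

lemma real_univ_singleton (a : R) :
    (uniformOn (Set.univ : Set R)).real {a} = (Fintype.card R : ℝ)⁻¹ := by
  simp [measureReal_def, uniformOn_univ]

lemma real_eq_sum (μ : Measure R) [IsProbabilityMeasure μ] (A : Set R)
    [DecidablePred (· ∈ A)] : μ.real A = ∑ a with a ∈ A, μ.real {a} := by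
  rw [sum_measureReal_singleton]
  congr 1
  ext; simp

lemma sum_real_singleton (μ : Measure R) [IsProbabilityMeasure μ] : ∑ a, μ.real {a} = 1 := by
  rw [sum_measureReal_singleton]
  simp

lemma conv_real_singleton {G : Type*} [AddCommGroup G] [Fintype G] [MeasurableSpace G]
    [DiscreteMeasurableSpace G] (ν κ : Measure G) [IsProbabilityMeasure ν]
    [IsProbabilityMeasure κ] (x : G) :
    (ν ∗ κ).real {x} = ∑ b, ν.real {x - b} * κ.real {b} := by
  rw [Measure.conv, map_measureReal_apply .of_discrete .of_discrete, real_eq_sum,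
    Finset.sum_filter, Fintype.sum_prod_type, Finset.sum_comm]
  refine Finset.sum_congr rfl fun b _ => ?_
  rw [Finset.sum_eq_single (x - b)]
  · rw [if_pos (by simp), ← Set.singleton_prod_singleton, measureReal_prod_prod]
  · intro a _ ha
    rw [if_neg]
    intro h
    exact ha (eq_sub_of_add_eq h)
  · simp

lemma uniformOn_real_singleton {G : Type*} [Fintype G] [MeasurableSpace G]
    [DiscreteMeasurableSpace G] (B : Set G) (b : G) :
    (uniformOn B).real {b} = if b ∈ B then (Nat.card B : ℝ)⁻¹ else 0 := by
  rw [measureReal_def, uniformOn, cond_apply .of_discrete, ENNReal.toReal_mul,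
    ENNReal.toReal_inv, Measure.count_apply .of_discrete, Set.encard]
  split_ifs with h
  · have : B ∩ {b} = {b} := by simpa using h
    rw [this]
    simp
  · have : B ∩ {b} = ∅ := by simpa using h
    rw [this]
    simp

variable {n k : ℕ}

lemma exists_atom_of_not_concentratedOn {μ : Measure R} [IsProbabilityMeasure μ] {A : Set R}
    (h : ¬ ConcentratedOn μ A) : ∃ y, y ∉ A ∧ μ.real {y} ≠ 0 := by
  by_contra hcon
  push Not at hcon
  apply h
  rw [ConcentratedOn, ← measureReal_eq_zero_iff, real_eq_sum]
  exact Finset.sum_eq_zero fun a ha => hcon a (Finset.mem_filter.1 ha).2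

lemma exists_isMinAtom (μ : Measure R) [IsProbabilityMeasure μ] : ∃ α, IsMinAtom μ α := by
  have hfin : {p : ℝ | p ≠ 0 ∧ ∃ r : R, μ.real {r} = p}.Finite :=
    (Set.finite_range fun r : R => μ.real {r}).subset fun p hp => hp.2
  have hne : {p : ℝ | p ≠ 0 ∧ ∃ r : R, μ.real {r} = p}.Nonempty := by
    by_contra hcon
    have hz : ∀ r : R, μ.real {r} = 0 := fun r => by
      by_contra hr
      exact hcon ⟨_, hr, r, rfl⟩
    have := sum_real_singleton μ
    simp [hz] at this
  exact hfin.exists_minimal hne |>.imp fun α h => ⟨h.1, fun p hp => by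
    rcases le_total α p with hle | hle
    · exact hle
    · exact h.2 hp hle⟩

/-- The probability mass function of the entry at the position `(i, j)`. -/
def entryMass (μ : Measure R) (S : Finset (Fin n × Fin k)) (i : Fin n) (j : Fin k) (a : R) : ℝ :=
  if (i, j) ∈ S then (Fintype.card R : ℝ)⁻¹ else μ.real {a}

lemma IsRandomMatrix.real_eq_matProb {μ : Measure R} [IsProbabilityMeasure μ]
    {S : Finset (Fin n × Fin k)} {Ω : Type*} [MeasurableSpace Ω] {P : Measure Ω}
    [IsProbabilityMeasure P] {𝓜 : Ω → Matrix (Fin n) (Fin k) R} (h : IsRandomMatrix μ S P 𝓜)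
    (M : Matrix (Fin n) (Fin k) R) : P.real {ω | 𝓜 ω = M} = matProb (entryMass μ S) M := by
  have hset : {ω | 𝓜 ω = M} = ⋂ p : Fin n × Fin k, {ω | 𝓜 ω p.1 p.2 = M p.1 p.2} := by
    ext ω
    simp only [Set.mem_ofPred_eq, Set.mem_iInter, Prod.forall]
    exact ⟨fun h i j => by rw [h], fun h => by ext i j; exact h i j⟩
  have hind := h.indep.meas_iInter
    (s := fun p : Fin n × Fin k => {ω | 𝓜 ω p.1 p.2 = M p.1 p.2})
    (fun p => ⟨{M p.1 p.2}, .of_discrete, by ext; simp⟩)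
  rw [hset, measureReal_def, hind, ENNReal.toReal_prod, matProb, Fintype.prod_prod_type_right]
  refine Finset.prod_congr rfl fun j _ => Finset.prod_congr rfl fun i _ => ?_
  have hl := (h.law (i, j)).measureReal_eq (p := fun x => x = M i j) .of_discrete
  rw [← measureReal_def]
  refine hl.trans ?_
  rw [entryMass]
  split_ifs
  · exact real_univ_singleton _
  · rfl

variable [CommRing R]

instance isProbabilityMeasure_uniformOn_submodule (B : Submodule R (Fin n → R)) :
    IsProbabilityMeasure (uniformOn (B : Set (Fin n → R))) :=
  isProbabilityMeasure_uniformOn (Set.toFinite _) ⟨0, B.zero_mem⟩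

lemma addUniform_iidVector_real (μ : Measure R) [IsProbabilityMeasure μ]
    (B : Submodule R (Fin n → R)) (x : Fin n → R) :
    (addUniform (iidVector μ n) B).real {x} = smearedMass (fun a => μ.real {a}) B x := by
  have : IsProbabilityMeasure (iidVector μ n) := by unfold iidVector; infer_instance
  rw [addUniform, conv_real_singleton, smearedMass]
  simp only [uniformOn_real_singleton, mul_ite, mul_zero]
  rw [← Finset.sum_filter, ← Finset.sum_mul, mul_comm]
  congr 1
  have hs : ∀ f : (Fin n → R) → ℝ, ∑ b with b ∈ (B : Set (Fin n → R)), f b = ∑ b : B, f b :=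
    fun f => Finset.sum_subtype _ (by simp) f
  rw [hs]
  refine Finset.sum_congr rfl fun b _ => ?_
  simp [iidVector, measureReal_def, Measure.pi_singleton, ENNReal.toReal_prod]

lemma addUniform_uniformVector_real (B : Submodule R (Fin n → R)) (x : Fin n → R) :
    (addUniform (uniformVector R n) B).real {x} = ((Fintype.card R : ℝ) ^ n)⁻¹ := by
  have : IsProbabilityMeasure (uniformVector R n) := by unfold uniformVector; infer_instance
  rw [addUniform, conv_real_singleton]
  simp only [uniformVector, real_univ_singleton]
  rw [← Finset.mul_sum, sum_real_singleton]
  simp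

lemma tvDist_le_one (μ : Measure R) [IsProbabilityMeasure μ] (B : Submodule R (Fin n → R)) :
    tvDist (addUniform (iidVector μ n) B) (addUniform (uniformVector R n) B) ≤ 1 := by
  have h1 : ∑ x, smearedMass (fun a => μ.real {a}) B x = 1 :=
    sum_smearedMass (sum_real_singleton μ) B
  have h2 : ∑ _x : Fin n → R, ((Fintype.card R : ℝ) ^ n)⁻¹ = 1 := by
    have hK : (Fintype.card R : ℝ) ≠ 0 := by exact_mod_cast Fintype.card_ne_zero
    simp [hK]
  simp only [tvDist, addUniform_iidVector_real, addUniform_uniformVector_real]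
  have h3 : ∑ x, |smearedMass (fun a => μ.real {a}) B x - ((Fintype.card R : ℝ) ^ n)⁻¹| ≤
      ∑ x, (smearedMass (fun a => μ.real {a}) B x + ((Fintype.card R : ℝ) ^ n)⁻¹) := by
    refine Finset.sum_le_sum fun x _ => ?_
    have ha := smearedMass_nonneg (w := fun a => μ.real {a}) (fun a => measureReal_nonneg) B x
    have hb : (0 : ℝ) ≤ ((Fintype.card R : ℝ) ^ n)⁻¹ := by positivity
    rw [abs_le]
    constructor <;> linarith
  rw [Finset.sum_add_distrib, h1, h2] at h3
  linarith

lemma tvDist_le_sqrt (μ : Measure R) [IsProbabilityMeasure μ] (M : Matrix (Fin n) (Fin k) R) :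
    tvDist (addUniform (iidVector μ n) (im M)) (addUniform (uniformVector R n) (im M)) ≤
      √(∑ φ : Fin n → AddChar R ℂ with φ ≠ 1 ∧ Kills φ M,
        ‖vecFourier (fun a => μ.real {a}) φ‖ ^ 2) := by
  simp only [tvDist, addUniform_iidVector_real, addUniform_uniformVector_real]
  have h := sum_abs_smearedMass_sub_le (w := fun a => μ.real {a}) (sum_real_singleton μ) M
  have h0 : 0 ≤ ∑ x, |smearedMass (fun a => μ.real {a}) (im M) x -
      ((Fintype.card R : ℝ) ^ n)⁻¹| := Finset.sum_nonneg fun x _ => abs_nonneg _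
  linarith

lemma swapDist_eq {μ : Measure R} [IsProbabilityMeasure μ]
    {S : Finset (Fin n × Fin k)} {Ω : Type*} [MeasurableSpace Ω] {P : Measure Ω}
    [IsProbabilityMeasure P] {𝓜 : Ω → Matrix (Fin n) (Fin k) R} (h : IsRandomMatrix μ S P 𝓜) :
    swapDist μ P 𝓜 = ∑ M, matProb (entryMass μ S) M *
      tvDist (addUniform (iidVector μ n) (im M)) (addUniform (uniformVector R n) (im M)) := by
  simp only [swapDist, h.real_eq_matProb]

variable [IsLocalRing R]

lemma Nondegenerate.exists_atom_residue_ne {μ : Measure R} [IsProbabilityMeasure μ]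
    (h : Nondegenerate μ) (x : IsLocalRing.ResidueField R) :
    ∃ y, IsLocalRing.residue R y ≠ x ∧ μ.real {y} ≠ 0 := by
  obtain ⟨a, rfl⟩ := IsLocalRing.residue_surjective x
  obtain ⟨y, hy, hy0⟩ := exists_atom_of_not_concentratedOn
    (h.not_ideal (IsLocalRing.maximalIdeal R) Ideal.IsPrime.ne_top' a)
  refine ⟨y, fun heq => hy ⟨y - a, ?_, by ring⟩, hy0⟩
  rw [← IsLocalRing.residue_eq_zero_iff, map_sub, heq, sub_self]

lemma Nondegenerate.spreads {μ : Measure R} [IsProbabilityMeasure μ] (h : Nondegenerate μ) :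
    Spreads {x | μ.real {x} ≠ 0} where
  exists_unit := by
    obtain ⟨x, _, hx⟩ := h.exists_atom_residue_ne 0
    obtain ⟨y, hy, hy0⟩ := h.exists_atom_residue_ne (IsLocalRing.residue R x)
    refine ⟨x, hx, y, hy0, ?_⟩
    by_contra hnu
    apply hy
    rw [← sub_eq_zero, ← map_sub, IsLocalRing.residue_eq_zero_iff]
    exact (IsLocalRing.mem_maximalIdeal _).2 hnu
  subring_eq_top := by
    intro T a c hT
    by_contra hne
    obtain ⟨y, hy, hy0⟩ := exists_atom_of_not_concentratedOn (h.not_subring T hne a c)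
    exact hy (hT y hy0)

instance finite_residueField : Finite (IsLocalRing.ResidueField R) :=
  Finite.of_surjective _ IsLocalRing.residue_surjective

lemma residueProb_eq_sum (μ : Measure R) [IsProbabilityMeasure μ]
    (x : IsLocalRing.ResidueField R) :
    residueProb μ x = ∑ a with IsLocalRing.residue R a = x, μ.real {a} := by
  rw [residueProb, real_eq_sum]
  rfl

lemma sum_residueProb [Fintype (IsLocalRing.ResidueField R)] (μ : Measure R)
    [IsProbabilityMeasure μ] : ∑ x, residueProb μ x = 1 := by
  simp only [residueProb_eq_sum]
  rw [← sum_real_singleton μ]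
  exact Finset.sum_fiberwise Finset.univ (IsLocalRing.residue R) fun a => μ.real {a}

lemma residueCollision_eq (μ : Measure R) [IsProbabilityMeasure μ] :
    residueCollision (fun a => μ.real {a}) = residueL2 μ ^ 2 := by
  have := Fintype.ofFinite (IsLocalRing.ResidueField R)
  rw [residueL2, finsum_eq_sum_of_fintype,
    Real.sq_sqrt (Finset.sum_nonneg fun x _ => sq_nonneg _), residueCollision]
  simp only [residueProb_eq_sum]
  rw [← Finset.sum_fiberwise Finset.univ (fun a => IsLocalRing.residue R a)]
  refine Finset.sum_congr rfl fun x _ => ?_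
  rw [sq, Finset.sum_mul_sum]
  refine Finset.sum_congr rfl fun a ha => ?_
  rw [← Finset.sum_filter]
  have ha := (Finset.mem_filter.1 ha).2
  refine Finset.sum_congr ?_ fun _ _ => rfl
  ext b
  simp [ha, eq_comm]

/-- Another residue class contains an atom, hence has mass at least `α`. This keeps class masses
below `θ` by a margin that depends only on `θ` and `α`, so the constant can be uniform in `μ`. -/
lemma residueProb_sq_add_sq_le {μ : Measure R} [IsProbabilityMeasure μ] (h : Nondegenerate μ)
    {α : ℝ} (hα0 : 0 < α) (hα : ∀ a, μ.real {a} ≠ 0 → α ≤ μ.real {a})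
    (x : IsLocalRing.ResidueField R) : residueProb μ x ^ 2 + α ^ 2 ≤ residueL2 μ ^ 2 := by
  have := Fintype.ofFinite (IsLocalRing.ResidueField R)
  obtain ⟨y, hy, hy0⟩ := h.exists_atom_residue_ne x
  have hay : α ≤ residueProb μ (IsLocalRing.residue R y) := by
    refine (hα y hy0).trans ?_
    rw [residueProb]
    exact measureReal_mono (by simp)
  rw [residueL2, finsum_eq_sum_of_fintype,
    Real.sq_sqrt (Finset.sum_nonneg fun x _ => sq_nonneg _)]
  calc residueProb μ x ^ 2 + α ^ 2
      ≤ residueProb μ x ^ 2 + residueProb μ (IsLocalRing.residue R y) ^ 2 := by gcongr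
    _ = ∑ z ∈ {x, IsLocalRing.residue R y}, residueProb μ z ^ 2 := by
        rw [Finset.sum_pair hy.symm]
    _ ≤ _ := Finset.sum_le_univ_sum_of_nonneg fun z => sq_nonneg _

/-- Uniform positions obey the same bounds as the others: atoms of mass `1 / |R|` account for the
minimum, and residue classes have mass at most `1 / p`. -/
lemma entryLaw_entryMass {n k : ℕ} {μ : Measure R} [IsProbabilityMeasure μ] {α ρ : ℝ}
    (hα : ∀ a, μ.real {a} ≠ 0 → α ≤ μ.real {a})
    (hρ : 1 / (ringChar (IsLocalRing.ResidueField R) : ℝ) ≤ ρ)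
    (hμ : ∀ x : IsLocalRing.ResidueField R, residueProb μ x ≤ ρ)
    (S : Finset (Fin n × Fin k)) (i : Fin n) (j : Fin k) :
    EntryLaw {x | μ.real {x} ≠ 0} (min α (Fintype.card R : ℝ)⁻¹) ρ (entryMass μ S i j) := by
  by_cases hS : (i, j) ∈ S
  · have he : entryMass μ S i j = fun _ => (Fintype.card R : ℝ)⁻¹ := by
      funext a; simp [entryMass, hS]
    have hK : (Fintype.card R : ℝ) ≠ 0 := by exact_mod_cast Fintype.card_ne_zero
    rw [he]
    exact ⟨fun a => by positivity, by simp [hK], fun _ _ => min_le_right _ _,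
      fun x => (uniform_sum_class_le R x).trans hρ⟩
  · have he : entryMass μ S i j = fun a => μ.real {a} := by
      funext a; simp [entryMass, hS]
    rw [he]
    exact ⟨fun a => measureReal_nonneg, sum_real_singleton μ,
      fun x hx => (min_le_left _ _).trans (hα x hx),
      fun x => (residueProb_eq_sum μ x).ge.trans (hμ x)⟩

/-- No residue class carries all the mass, since a class is a translate of the maximal ideal. -/
lemma Nondegenerate.rate_lt_one {μ : Measure R} [IsProbabilityMeasure μ] (h : Nondegenerate μ) :
    rate μ < 1 := by
  have := Fintype.ofFinite (IsLocalRing.ResidueField R)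
  have hlt : ∀ x, residueProb μ x < 1 := by
    intro x
    obtain ⟨y, hy, hy0⟩ := h.exists_atom_residue_ne x
    have hpos : 0 < residueProb μ (IsLocalRing.residue R y) :=
      (lt_of_le_of_ne measureReal_nonneg hy0.symm).trans_le (measureReal_mono (by simp))
    have hpair : ∑ z ∈ {x, IsLocalRing.residue R y}, residueProb μ z ≤ ∑ z, residueProb μ z :=
      Finset.sum_le_univ_sum_of_nonneg fun z => measureReal_nonneg
    rw [Finset.sum_pair hy.symm, sum_residueProb] at hpair
    linarith
  refine max_lt ?_ (max_lt ?_ ?_)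
  · rw [residueL2, finsum_eq_sum_of_fintype, Real.sqrt_lt' one_pos, one_pow]
    obtain ⟨y, _, hy0⟩ := h.exists_atom_residue_ne 0
    have hpos : 0 < residueProb μ (IsLocalRing.residue R y) :=
      (lt_of_le_of_ne measureReal_nonneg hy0.symm).trans_le (measureReal_mono (by simp))
    rw [← sum_residueProb μ]
    refine Finset.sum_lt_sum (fun x _ => ?_) ⟨IsLocalRing.residue R y, Finset.mem_univ _, ?_⟩
    · have h0 : 0 ≤ residueProb μ x := measureReal_nonneg
      nlinarith [hlt x]
    · nlinarith [hlt (IsLocalRing.residue R y)]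
  · obtain ⟨x, hx⟩ := exists_eq_ciSup_of_finite (f := residueProb μ)
    rw [residueLinf, ← hx]
    exact hlt x
  · have hp := (prime_ringChar_residueField R).one_lt
    rw [div_lt_one (by positivity)]
    exact_mod_cast hp

variable (R) in
/-- The quantitative column-swapping estimate. -/
theorem exists_swapDist_le (u : ℤ) {θ α : ℝ} (hθ : θ < 1) : ∃ C : ℝ,
    ∀ μ : Measure R, IsProbabilityMeasure μ → Nondegenerate μ → IsMinAtom μ α → rate μ < θ →
      ∀ n k : ℕ, (k : ℤ) = n + u → ∀ S : Finset (Fin n × Fin k),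
      ∀ (Ω : Type*) [MeasurableSpace Ω] (P : Measure Ω) [IsProbabilityMeasure P]
        (𝓜 : Ω → Matrix (Fin n) (Fin k) R),
        IsRandomMatrix μ S P 𝓜 → swapDist μ P 𝓜 ≤ C * θ ^ n := by
  -- The constant is chosen before `μ`. If this condition fails, no `μ` meets the hypotheses and any
  -- constant works.
  by_cases hex : 0 < α ∧ 1 / (ringChar (IsLocalRing.ResidueField R) : ℝ) < θ
  swap
  · refine ⟨0, fun μ hμ _ hα hrate => absurd ⟨?_, ?_⟩ hex⟩
    · obtain ⟨hα0, r, hr⟩ := hα.1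
      exact lt_of_le_of_ne (hr ▸ measureReal_nonneg) hα0.symm
    · exact ((le_max_right _ _).trans (le_max_right _ _)).trans_lt hrate
  obtain ⟨hα0, hpθ⟩ := hex
  have hp0 : 0 < 1 / (ringChar (IsLocalRing.ResidueField R) : ℝ) :=
    one_div_pos.2 (by exact_mod_cast (prime_ringChar_residueField R).pos)
  have hθ0 : 0 < θ := hp0.trans hpθ
  -- This `ρ` depends on `R`, `θ` and `α` only, and bounds every class mass by
  -- `residueProb_sq_add_sq_le`.
  set ρ := max (1 / (ringChar (IsLocalRing.ResidueField R) : ℝ)) √(θ ^ 2 - α ^ 2) with hρ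
  have hρθ : ρ < θ := by
    refine max_lt hpθ ?_
    rw [Real.sqrt_lt' hθ0]
    linarith [pow_pos hα0 2]
  have hK : (0 : ℝ) < (Fintype.card R : ℝ)⁻¹ := inv_pos.2 (by exact_mod_cast Fintype.card_pos)
  obtain ⟨C, hC⟩ := exists_sum_matProb_mul_le R (lt_min hα0 hK) (le_max_left _ _) hρθ hθ u.natAbs
  refine ⟨C, fun μ _ hnd hα hrate n k hk S Ω _ P _ 𝓜 h𝓜 => ?_⟩
  have hatom : ∀ a, μ.real {a} ≠ 0 → α ≤ μ.real {a} := fun a ha => hα.2 ⟨ha, a, rfl⟩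
  have hL2 : residueL2 μ ^ 2 ≤ θ ^ 2 :=
    pow_le_pow_left₀ (Real.sqrt_nonneg _) ((le_max_left _ _).trans hrate.le) 2
  have hclass : ∀ x : IsLocalRing.ResidueField R, residueProb μ x ≤ ρ := by
    intro x
    refine le_trans (Real.le_sqrt_of_sq_le ?_) (le_max_right _ _)
    linarith [residueProb_sq_add_sq_le hnd hα0 hatom x]
  rw [swapDist_eq h𝓜]
  exact hC _ hnd.spreads _ (fun a => measureReal_nonneg) ((residueCollision_eq μ).trans_le hL2)
    n k (by omega) (by omega) _ (entryLaw_entryMass hatom (le_max_left _ _) hclass S) _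
    (fun M => tvDist_le_one μ (im M)) (fun M => tvDist_le_sqrt μ M)

end Laws

end ColumnSwap

end

open ColumnSwap
/-- The column-swapping estimate, in qualitative and in quantitative form. -/
theorem mainTheorem2 (R : Type*) [CommRing R] [IsLocalRing R] [Fintype R]
    [MeasurableSpace R] [DiscreteMeasurableSpace R] :
    (∀ μ : Measure R, IsProbabilityMeasure μ → Nondegenerate μ →
      ∃ θ : ℝ, 0 < θ ∧ θ < 1 ∧ ∀ u : ℤ, ∃ C : ℝ,
        ∀ n k : ℕ, (k : ℤ) = n + u → ∀ S : Finset (Fin n × Fin k),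
        ∀ (Ω : Type*) [MeasurableSpace Ω] (P : Measure Ω) [IsProbabilityMeasure P]
          (𝓜 : Ω → Matrix (Fin n) (Fin k) R),
          IsRandomMatrix μ S P 𝓜 → swapDist μ P 𝓜 ≤ C * θ ^ n) ∧
    (∀ (u : ℤ) (θ α : ℝ), θ < 1 → ∃ C : ℝ,
      ∀ μ : Measure R, IsProbabilityMeasure μ → Nondegenerate μ → IsMinAtom μ α → rate μ < θ →
        ∀ n k : ℕ, (k : ℤ) = n + u → ∀ S : Finset (Fin n × Fin k),
        ∀ (Ω : Type*) [MeasurableSpace Ω] (P : Measure Ω) [IsProbabilityMeasure P]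
          (𝓜 : Ω → Matrix (Fin n) (Fin k) R),
          IsRandomMatrix μ S P 𝓜 → swapDist μ P 𝓜 ≤ C * θ ^ n) := by
  refine ⟨fun μ hμ hnd => ?_, fun u θ α hθ => exists_swapDist_le R u hθ⟩
  obtain ⟨θ, hθ, hθ1⟩ := exists_between hnd.rate_lt_one
  obtain ⟨α, hα⟩ := exists_isMinAtom μ
  have hθ0 : 0 < θ := by
    refine lt_of_le_of_lt ?_ hθ
    exact (Real.sqrt_nonneg _).trans (le_max_left _ _)
  refine ⟨θ, hθ0, hθ1, fun u => ?_⟩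
  obtain ⟨C, hC⟩ := exists_swapDist_le R u (α := α) hθ1
  exact ⟨C, hC μ hμ hnd hα hθ⟩
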